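/- Let $\mathcal X\subset\mathbb R^d$, $\mathcal Y\subset\mathbb R$, $\mathcal Z=\mathcal X\times\mathcal Y$, and let $\rho$ be a probability measure on $\mathcal Z$. Let $K:\mathcal X\times\mathcal X\to\mathbb R$ be a Mercer kernel (continuous, symmetric, positive semi-definite) with $\kappa:=\sup_{x\in\mathcal X}\sqrt{K(x,x)}<\infty$, let $H_K$ be its reproducing kernel Hilbert space, and write $K_x=K(x,\cdot)\in H_K$. Let $\alpha\in(0,1]$ and $L>0$. Let $\phi:\mathcal Y\times\mathbb R\to[0,\infty)$ be a measurable loss function which is convex and differentiable in its second argument, with derivative $\phi'$ in the second argument satisfying $$|\phi'(y,s)-\phi'(y,\tilde s)|\le L|s-\tilde s|^\alpha\qquad\text{for all } s,\tilde s\in\mathbb R,\ y\in\mathcal Y.$$ For $f:\mathcal X\to\mathbb R$ let $\mathcal E(f)=\int_{\mathcal Z}\phi(y,f(x))\,d\rho(x,y)$. Assume that a minimizer $f_H$ of $\mathcal E$ over $H_K$ exists and that $$\max\Big\{\sup_{y\in\mathcal Y}\phi(y,0),\ \sup_{(x,y)\in\mathcal Z}\phi(y,f_H(x))\Big\}<\infty.$$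 Let $A=2\alpha^{\frac{1-\alpha}{1+\alpha}}L^{\frac{2}{1+\alpha}}(1+\alpha)$, and let $(\eta_t)_{t\ge1}$ be a sequence of positive step sizes with $A\kappa^2\eta_t\le1$ and $\eta_{t+1}\le\eta_t$ for all $t\ge1$, and $\sum_{t=1}^\infty\eta_t^2<\infty$. Let $z_t=(x_t,y_t)$, $t\ge1$, be drawn independently from $\rho$, and let the iterates of online gradient descent be given by $f_1=0$ and $$f_{t+1}=f_t-\eta_t\,\phi'(y_t,f_t(x_t))\,K_{x_t},\qquad t\ge1.$$ Then there exists a constant $\widetilde C'$, independent of $T$ and $\delta$, such that for every integer $T\ge2$ and every $\delta\in(0,1)$, with probability at least $1-\delta$, $$\mathcal E(f_{T+1})-\mathcal E(f_H)\le\widetilde C'\max\Big\{\Big[\sum_{t=\lfloor T/2\rfloor}^{T}\eta_t\Big]^{-1},\ \eta_{\lfloor T/2\rfloor}^{\alpha},\ \sum_{t=\lfloor T/2\rfloor}^{T}\eta_t^{1+\alpha}\Big\}\log^2\frac{3T}{\delta},$$ where $\lfloor T/2\rfloor$ is the largest integer not greater than $T/2$. -/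

import Mathlib

open MeasureTheory ProbabilityTheory

noncomputable section

/-- A Mercer kernel: a continuous, symmetric and positive semi-definite function on `X × X`. -/
structure IsMercerKernel {X : Type*} [TopologicalSpace X] (K : X → X → ℝ) : Prop where
  continuous : Continuous fun p : X × X => K p.1 p.2
  symm : ∀ x x', K x x' = K x' x
  posSemidef : ∀ (n : ℕ) (x : Fin n → X) (c : Fin n → ℝ),
    0 ≤ ∑ i, ∑ j, c i * c j * K (x i) (x j)

/-- The kernel section `K_x ∈ H` at `x`: the representer of the evaluation `f ↦ f x` in the
real reproducing kernel Hilbert space `H` of functions on `X`. -/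
def kernelSection {X : Type*} (H : Type*) [NormedAddCommGroup H] [InnerProductSpace ℝ H]
    [CompleteSpace H] [RKHS ℝ H X ℝ] (x : X) : H :=
  RKHS.kerFun H x (1 : ℝ)

/-- `H` is the reproducing kernel Hilbert space of the kernel `K`: the representers of the point
evaluations in `H` are the functions `K(x, ·)`. -/
def IsRKHSOf {X : Type*} (H : Type*) [NormedAddCommGroup H] [InnerProductSpace ℝ H]
    [CompleteSpace H] [RKHS ℝ H X ℝ] (K : X → X → ℝ) : Prop :=
  ∀ x x' : X, kernelSection H x x' = K x x'

/-- `κ = sup_x √(K(x, x))`. -/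
def kernelSup {X : Type*} (K : X → X → ℝ) : ℝ :=
  ⨆ x, √(K x x)

/-- The loss `φ : Y × ℝ → ℝ₊` is measurable, nonnegative, convex and differentiable with respect
to its second argument, and its derivative with respect to the second argument is
`(α, L)`-Hölder continuous, with `α ∈ (0, 1]` and `L > 0`. -/
structure IsHolderLoss {Y : Type*} [MeasurableSpace Y] (φ : Y → ℝ → ℝ) (α L : ℝ) : Prop where
  alpha_pos : 0 < α
  alpha_le_one : α ≤ 1
  L_pos : 0 < L
  measurable : Measurable fun p : Y × ℝ => φ p.1 p.2
  nonneg : ∀ y s, 0 ≤ φ y s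
  convex : ∀ y, ConvexOn ℝ Set.univ (φ y)
  differentiable : ∀ y, Differentiable ℝ (φ y)
  holder : ∀ y s s', |deriv (φ y) s - deriv (φ y) s'| ≤ L * |s - s'| ^ α

/-- The generalization error `ℰ(f) = ∫ φ(y, f(x)) dρ(x, y)`. -/
def genError {X Y : Type*} [MeasurableSpace X] [MeasurableSpace Y] (ρ : Measure (X × Y))
    (φ : Y → ℝ → ℝ) (f : X → ℝ) : ℝ :=
  ∫ z, φ z.2 (f z.1) ∂ρ

/-- The constant `A = 2 α^((1-α)/(1+α)) L^(2/(1+α)) (1+α)`. -/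
def selfBoundConst (α L : ℝ) : ℝ :=
  2 * α ^ ((1 - α) / (1 + α)) * L ^ (2 / (1 + α)) * (1 + α)

/-- Online gradient descent: `f₁ = 0` and `f_{t+1} = f_t - η_t φ'(y_t, f_t(x_t)) K_{x_t}` for
`t ≥ 1`, along the sequence of examples `z_t = (x_t, y_t)`, `t ≥ 1`. Indices start at `1`: the
value at `0` is a placeholder, and `η 0`, `z 0` are not used. -/
def ogd {X Y : Type*} (H : Type*) [NormedAddCommGroup H] [InnerProductSpace ℝ H]
    [CompleteSpace H] [RKHS ℝ H X ℝ] (φ : Y → ℝ → ℝ) (η : ℕ → ℝ) (z : ℕ → X × Y) : ℕ → H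
  | 0 => 0
  | 1 => 0
  | t + 2 =>
    ogd H φ η z (t + 1) -
      (η (t + 1) * deriv (φ (z (t + 1)).2) (ogd H φ η z (t + 1) (z (t + 1)).1)) •
        kernelSection H (z (t + 1)).1

end

/-! Two pathwise recursions are controlled by exponential supermartingales. Write ℓ for the sampled
loss and gap for the excess risk. Convexity and the self-bounding property of the loss give ‖f_{k+1}
- f_H‖² ≤ ‖f_k - f_H‖² + c_k (ℓ(f_H) - ℓ(f_k)) + κ² N η_k², with η_k ≤ c_k ≤ 2 η_k. The loss
difference is bounded above, has conditional mean -gap(f_k), and has second moment at most κ² ‖f_k -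
f_H‖² (A gap(f_k) + 2N). Half of the negative drift absorbs the gap part, because η_k ‖f_k - f_H‖²
is bounded on every path; the other part carries η_k² and is absorbed by induction, as Σ η_k² < ∞.
Hence, with high probability, every ‖f_k - f_H‖² and Σ η_k gap(f_k) are O(l), where l = log(3T/δ)
(`dist_and_sum_gap_le`).

For the last iterate, Hölder smoothness gives gap(f_{k+1}) ≤ gap(f_k) - η_k ⟨∇_k, g_k⟩ + O(G
η_k^{1+α}), with g_k the sampled gradient, ∇_k its mean and G a bound for ‖g_k‖². Weighting by the
partial sums of the steps over the window and summing by parts bounds S gap(f_{T+1}), S being the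
total step length, by Σ η_k gap(f_k) plus these errors (`sum_mul_gap_sgd_le`). The correlation ⟨∇_k,
g_k⟩ has mean ‖∇_k‖² and second moment at most G ‖∇_k‖², so after scaling by G its drift pays for
its variance (`lintegral_exp_corrIncr_le_one`). Dividing by S leaves the three terms of the maximum;
G is itself O(l), which makes the logarithm squared. -/

/-! ### Hölder-smooth convex functions of one variable -/

/-- First-order Taylor bound for a function with a Hölder continuous derivative. -/
lemma taylor_le_of_holder_deriv {g : ℝ → ℝ} {α L : ℝ} (hα : 0 < α) (hL : 0 < L)
    (hg : Differentiable ℝ g) (hh : ∀ s s', |deriv g s - deriv g s'| ≤ L * |s - s'| ^ α)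
    (s t : ℝ) : g t ≤ g s + deriv g s * (t - s) + L * |t - s| ^ (1 + α) := by
  rcases eq_or_ne s t with rfl | hne
  · have : (0 : ℝ) ^ (1 + α) = 0 := Real.zero_rpow (by linarith)
    simp [this]
  obtain ⟨c, hc, hc'⟩ : ∃ c, |c - s| ≤ |t - s| ∧ g t - g s = deriv g c * (t - s) := by
    rcases lt_or_gt_of_ne hne with h | h
    · obtain ⟨c, hc, hc'⟩ := exists_deriv_eq_slope g h hg.continuous.continuousOn
        hg.differentiableOn
      refine ⟨c, ?_, ?_⟩
      · rw [abs_of_pos (by linarith [hc.1]), abs_of_pos (by linarith)]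
        linarith [hc.2]
      · rw [hc', div_mul_cancel₀ _ (by linarith)]
    · obtain ⟨c, hc, hc'⟩ := exists_deriv_eq_slope g h hg.continuous.continuousOn
        hg.differentiableOn
      refine ⟨c, ?_, ?_⟩
      · rw [abs_of_neg (by linarith [hc.2]), abs_of_neg (by linarith)]
        linarith [hc.1]
      · have : s - t ≠ 0 := by linarith
        rw [hc']; field_simp; ring
  have h1 : (deriv g c - deriv g s) * (t - s) ≤ L * |t - s| ^ (1 + α) := by
    calc (deriv g c - deriv g s) * (t - s) ≤ |deriv g c - deriv g s| * |t - s| := by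
          rw [← abs_mul]; exact le_abs_self _
      _ ≤ (L * |t - s| ^ α) * |t - s| := by
          refine mul_le_mul_of_nonneg_right ((hh c s).trans ?_) (abs_nonneg _)
          gcongr
      _ = L * |t - s| ^ (1 + α) := by
          have : 0 < |t - s| := abs_pos.2 (sub_ne_zero.2 hne.symm)
          rw [Real.rpow_add this, Real.rpow_one]; ring
  linarith

lemma selfBoundConst_pos {α L : ℝ} (hα : 0 < α) (hL : 0 < L) : 0 < selfBoundConst α L := by
  unfold selfBoundConst
  positivity

/-- A power `x ^ (1 + α)` with `α < 1` is dominated by any multiple of `x ^ 2` up to a constant. -/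
lemma exists_mul_rpow_le_mul_sq_add {α a b : ℝ} (hα : 0 < α) (hα1 : α < 1) (ha : 0 ≤ a)
    (hb : 0 < b) : ∃ B, 0 ≤ B ∧ ∀ x, 0 ≤ x → a * x ^ (1 + α) ≤ b * x ^ 2 + B := by
  -- The crossover point, where `a * x ^ (1 + α) = b * x ^ 2`.
  set x₀ : ℝ := (a / b) ^ (1 / (1 - α)) with hx₀
  have hx₀0 : 0 ≤ x₀ := by positivity
  refine ⟨a * x₀ ^ (1 + α), by positivity, fun x hx => ?_⟩
  rcases le_total x x₀ with h | h
  · have : a * x ^ (1 + α) ≤ a * x₀ ^ (1 + α) := by gcongr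
    have : 0 ≤ b * x ^ 2 := by positivity
    linarith
  · have h1 : a / b ≤ x ^ (1 - α) := by
      calc a / b = x₀ ^ (1 - α) := by
            rw [hx₀, ← Real.rpow_mul (by positivity), one_div, inv_mul_cancel₀ (by linarith),
              Real.rpow_one]
        _ ≤ x ^ (1 - α) := Real.rpow_le_rpow hx₀0 h (by linarith)
    have h2 : x ^ 2 = x ^ (1 - α) * x ^ (1 + α) := by
      rw [← Real.rpow_add' hx (by norm_num), ← Real.rpow_natCast]
      norm_num
    have h3 : a ≤ b * x ^ (1 - α) := by rw [div_le_iff₀ hb] at h1; linarith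
    have h4 : 0 ≤ x ^ (1 + α) := by positivity
    have h5 : 0 ≤ a * x₀ ^ (1 + α) := by positivity
    rw [h2]
    nlinarith [mul_le_mul_of_nonneg_right h3 h4]

/-- Self-bounding property: the squared derivative of a nonnegative function with Hölder
continuous derivative is bounded by an affine function of its value. -/
lemma exists_deriv_sq_le {α L : ℝ} (hα : 0 < α) (hα1 : α ≤ 1) (hL : 0 < L) :
    ∃ B, 0 ≤ B ∧ ∀ g : ℝ → ℝ, Differentiable ℝ g → (∀ s, 0 ≤ g s) →
      (∀ s s', |deriv g s - deriv g s'| ≤ L * |s - s'| ^ α) →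
      ∀ s, deriv g s ^ 2 ≤ selfBoundConst α L * g s + B := by
  set A := selfBoundConst α L with hA
  have hA0 : 0 < A := selfBoundConst_pos hα hL
  -- The left side is the Taylor remainder of a step of length `2 * p / A`. For `α = 1` one has `A =
  -- 4 * L`, both sides agree and `B = 0` works.
  obtain ⟨B, hB0, hB⟩ : ∃ B, 0 ≤ B ∧ ∀ p, 0 ≤ p → L * (2 * p / A) ^ (1 + α) ≤ p ^ 2 / A + B := by
    rcases hα1.lt_or_eq with h | rfl
    · obtain ⟨B, hB0, hB⟩ := exists_mul_rpow_le_mul_sq_add (b := A / 4) hα h hL.le (by positivity)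
      refine ⟨B, hB0, fun p hp => (hB (2 * p / A) (by positivity)).trans (le_of_eq ?_)⟩
      field_simp; ring
    · refine ⟨0, le_rfl, fun p hp => ?_⟩
      have h4 : A = 4 * L := by
        rw [hA, selfBoundConst]; norm_num; ring
      have h2 : (1 + 1 : ℝ) = (2 : ℕ) := by norm_num
      rw [h4, h2, Real.rpow_natCast]
      apply le_of_eq; field_simp; ring
  refine ⟨A * B, by positivity, fun g hg h0 hh s => ?_⟩
  -- A gradient step of size `2 / A`: nonnegativity of `g` at its endpoint bounds the decrease,
  -- hence the derivative, by `g s`.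
  have key := taylor_le_of_holder_deriv hα hL hg hh s (s - 2 * deriv g s / A)
  have h1 := hB |deriv g s| (abs_nonneg _)
  have h2 : |s - 2 * deriv g s / A - s| = 2 * |deriv g s| / A := by
    rw [show s - 2 * deriv g s / A - s = -(2 * deriv g s / A) by ring, abs_neg, abs_div, abs_mul,
      abs_of_pos hA0, abs_two]
  rw [h2] at key
  rw [sq_abs] at h1
  have h3 := h0 (s - 2 * deriv g s / A)
  have h4 : 0 ≤ g s - deriv g s ^ 2 / A + B := by
    have : deriv g s * (s - 2 * deriv g s / A - s) = - (2 * (deriv g s ^ 2 / A)) := by ring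
    linarith
  have h5 : A * (deriv g s ^ 2 / A) = deriv g s ^ 2 := by field_simp
  nlinarith [mul_nonneg hA0.le h4]

lemma deriv_mul_sub_le_of_convexOn {g : ℝ → ℝ} (hg : Differentiable ℝ g)
    (hc : ConvexOn ℝ Set.univ g) (s t : ℝ) : g s + deriv g s * (t - s) ≤ g t := by
  rcases lt_trichotomy s t with h | rfl | h
  · have := hc.deriv_le_slope (Set.mem_univ s) (Set.mem_univ t) h (hg s)
    rw [slope_def_field, le_div_iff₀ (by linarith)] at this
    linarith
  · simp
  · have := hc.slope_le_deriv (Set.mem_univ t) (Set.mem_univ s) h (hg s)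
    rw [slope_def_field, div_le_iff₀ (by linarith)] at this
    linarith

/-- Increments of a convex function with self-bounded derivative. -/
lemma sq_sub_le_of_convexOn {g : ℝ → ℝ} (hg : Differentiable ℝ g)
    (hc : ConvexOn ℝ Set.univ g) {s t b : ℝ} (hs : deriv g s ^ 2 ≤ b) (ht : deriv g t ^ 2 ≤ b) :
    (g t - g s) ^ 2 ≤ (t - s) ^ 2 * b := by
  have h1 := deriv_mul_sub_le_of_convexOn hg hc s t
  have h2 := deriv_mul_sub_le_of_convexOn hg hc t s
  rcases le_total 0 (g t - g s) with h | h
  · calc (g t - g s) ^ 2 ≤ (deriv g t * (t - s)) ^ 2 := by gcongr; linarith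
      _ = (t - s) ^ 2 * deriv g t ^ 2 := by ring
      _ ≤ _ := by gcongr
  · calc (g t - g s) ^ 2 = (g s - g t) ^ 2 := by ring
      _ ≤ (deriv g s * (s - t)) ^ 2 := by
        apply pow_le_pow_left₀ (by linarith); linarith
      _ = (t - s) ^ 2 * deriv g s ^ 2 := by ring
      _ ≤ _ := by gcongr

/-! ### Exponential moments along an i.i.d. sequence -/

/-- No lower bound on `x` is needed, since for `x ≤ -1` the right side is at least `1`. This matters
for loss differences, which are uniformly bounded only from above. -/
lemma Real.exp_le_one_add_add_sq {x : ℝ} (hx : x ≤ 1) : Real.exp x ≤ 1 + x + x ^ 2 := by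
  rcases le_total (-1) x with h | h
  · have := (abs_le.1 (Real.abs_exp_sub_one_sub_id_le (abs_le.2 ⟨h, hx⟩))).2
    linarith
  · have := Real.exp_le_one_iff.2 (by linarith : x ≤ 0)
    nlinarith

lemma Real.rpow_le_one_add_self {x p : ℝ} (hx : 0 ≤ x) (hp : 0 ≤ p) (hp1 : p ≤ 1) :
    x ^ p ≤ 1 + x := by
  calc x ^ p ≤ (1 + x) ^ p := by gcongr; linarith
    _ ≤ (1 + x) ^ (1 : ℝ) := Real.rpow_le_rpow_of_exponent_le (by linarith) hp1
    _ = 1 + x := Real.rpow_one _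

/-- The exponential of a random variable that is bounded above by `1`, controlled by its first two
moments. -/
lemma lintegral_exp_sub_le_one {Z : Type*} [MeasurableSpace Z] {ρ : Measure Z}
    [IsProbabilityMeasure ρ] {x : Z → ℝ} {c : ℝ} (hx : Integrable x ρ)
    (hx2 : Integrable (fun z => x z ^ 2) ρ) (hx1 : ∀ z, x z ≤ 1)
    (hc : ∫ z, x z ∂ρ + ∫ z, x z ^ 2 ∂ρ ≤ c) :
    ∫⁻ z, ENNReal.ofReal (Real.exp (x z - c)) ∂ρ ≤ 1 := by
  have hint : Integrable (fun z => (1 + x z + x z ^ 2) * Real.exp (-c)) ρ :=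
    (((integrable_const 1).add hx).add hx2).mul_const _
  calc ∫⁻ z, ENNReal.ofReal (Real.exp (x z - c)) ∂ρ
      ≤ ∫⁻ z, ENNReal.ofReal ((1 + x z + x z ^ 2) * Real.exp (-c)) ∂ρ := by
        refine lintegral_mono fun z => ENNReal.ofReal_le_ofReal ?_
        rw [sub_eq_add_neg, Real.exp_add]
        exact mul_le_mul_of_nonneg_right (Real.exp_le_one_add_add_sq (hx1 z)) (Real.exp_nonneg _)
    _ = ENNReal.ofReal (∫ z, (1 + x z + x z ^ 2) * Real.exp (-c) ∂ρ) := by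
        rw [ofReal_integral_eq_lintegral_ofReal hint]
        refine Filter.Eventually.of_forall fun z => ?_
        have : 0 ≤ 1 + x z + x z ^ 2 := by nlinarith [sq_nonneg (1 + x z), sq_nonneg (x z)]
        exact mul_nonneg this (Real.exp_nonneg _)
    _ ≤ 1 := by
        rw [integral_mul_const, integral_add, integral_add (integrable_const 1) hx,
          ← ENNReal.ofReal_one]
        · apply ENNReal.ofReal_le_ofReal
          have h1 : ∫ _ : Z, (1 : ℝ) ∂ρ = 1 := by simp
          rw [h1]
          calc (1 + ∫ z, x z ∂ρ + ∫ z, x z ^ 2 ∂ρ) * Real.exp (-c)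
              ≤ Real.exp c * Real.exp (-c) := by
                gcongr
                linarith [Real.add_one_le_exp c]
            _ = 1 := by rw [← Real.exp_add]; simp
        · exact (integrable_const 1).add hx
        · exact hx2

/-- The `σ`-algebra generated by the first `t` terms of a random sequence. -/
abbrev pastSigma {Ω Z : Type*} [MeasurableSpace Z] (z : ℕ → Ω → Z) (t : ℕ) : MeasurableSpace Ω :=
  ⨆ i ∈ Set.Iio t, MeasurableSpace.comap (z i) inferInstance

section
variable {Ω Z E : Type*} [MeasurableSpace Z] {z : ℕ → Ω → Z}

lemma pastSigma_mono : Monotone (pastSigma z) := fun _ _ h =>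
  biSup_mono fun _ hi => lt_of_lt_of_le hi h

lemma measurable_pastSigma {i t : ℕ} (h : i < t) : Measurable[pastSigma z t] (z i) := by
  have : MeasurableSpace.comap (z i) inferInstance ≤ pastSigma z t :=
    le_biSup (fun i => MeasurableSpace.comap (z i) inferInstance) (show i ∈ Set.Iio t from h)
  exact (comap_measurable (z i)).mono this le_rfl

variable [MeasurableSpace Ω] [MeasurableSpace E] {P : Measure Ω}

lemma pastSigma_le (hz : ∀ i, Measurable (z i)) (t : ℕ) : pastSigma z t ≤ ‹MeasurableSpace Ω› :=
  iSup₂_le fun i _ => (hz i).comap_le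

lemma indepFun_of_measurable_pastSigma (hz : ∀ i, Measurable (z i)) (hind : iIndepFun z P) {t : ℕ}
    {F : Ω → E} (hF : Measurable[pastSigma z t] F) : IndepFun F (z t) P := by
  have h1 : iIndep (fun i => MeasurableSpace.comap (z i) inferInstance) P :=
    (iIndepFun_iff_iIndep _ _ _).1 hind
  have h2 := indep_iSup_of_disjoint (fun i => (hz i).comap_le) h1
    (S := Set.Iio t) (T := {t}) (by simp)
  rw [IndepFun_iff_Indep]
  refine indep_of_indep_of_le_left (indep_of_indep_of_le_right h2 ?_) hF.comap_le
  simp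

variable [IsProbabilityMeasure P] {ρ : Measure Z} [IsProbabilityMeasure ρ]

/-- Exponential moments of sums along an i.i.d. sequence: conditionally unbiased factors give a
supermartingale. -/
lemma lintegral_exp_sum_le_one (hz : ∀ i, Measurable (z i)) (hind : iIndepFun z P)
    (hlaw : ∀ i, P.map (z i) = ρ) {F : ℕ → Ω → E} (hF : ∀ t, Measurable[pastSigma z t] (F t))
    {h : ℕ → E × Z → ℝ} (hh : ∀ t, Measurable (h t))
    (hle : ∀ t ω, ∫⁻ w, ENNReal.ofReal (Real.exp (h t (F t ω, w))) ∂ρ ≤ 1) (n : ℕ) :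
    ∫⁻ ω, ENNReal.ofReal (Real.exp (∑ k ∈ Finset.range n, h k (F k ω, z k ω))) ∂P ≤ 1 := by
  induction n with
  | zero => simp
  | succ n ih =>
    set a : Ω → ENNReal := fun ω =>
      ENNReal.ofReal (Real.exp (∑ k ∈ Finset.range n, h k (F k ω, z k ω))) with ha
    have ha_meas : Measurable[pastSigma z n] a := by
      refine ENNReal.measurable_ofReal.comp (Real.measurable_exp.comp ?_)
      refine Finset.measurable_sum _ fun k hk => (hh k).comp ?_
      have hk' := Finset.mem_range.1 hk
      exact ((hF k).mono (pastSigma_mono hk'.le) le_rfl).prodMk (measurable_pastSigma hk')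
    have hle_n := pastSigma_le hz n
    have hpair : Measurable[pastSigma z n] fun ω => (a ω, F n ω) := ha_meas.prodMk (hF n)
    have hpair' : Measurable fun ω => (a ω, F n ω) := hpair.mono hle_n le_rfl
    -- The past product and the current state are jointly independent of `z n`, so Tonelli's theorem
    -- integrates out `z n` with the state frozen.
    have hmap := (indepFun_iff_map_prod_eq_prod_map_map hpair'.aemeasurable (hz n).aemeasurable).1
      (indepFun_of_measurable_pastSigma hz hind hpair)
    rw [hlaw] at hmap
    have hG : Measurable fun q : E × Z => ENNReal.ofReal (Real.exp (h n q)) :=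
      ENNReal.measurable_ofReal.comp (Real.measurable_exp.comp (hh n))
    have hJ : Measurable fun p : (ENNReal × E) × Z =>
        p.1.1 * ENNReal.ofReal (Real.exp (h n (p.1.2, p.2))) := by
      refine (measurable_fst.comp measurable_fst).mul (hG.comp ?_)
      exact (measurable_snd.comp measurable_fst).prodMk measurable_snd
    have hI : Measurable fun p : ENNReal × E =>
        ∫⁻ w, p.1 * ENNReal.ofReal (Real.exp (h n (p.2, w))) ∂ρ := hJ.lintegral_prod_right'
    have : IsProbabilityMeasure (P.map fun ω => (a ω, F n ω)) :=
      Measure.isProbabilityMeasure_map hpair'.aemeasurable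
    calc ∫⁻ ω, ENNReal.ofReal (Real.exp (∑ k ∈ Finset.range (n + 1), h k (F k ω, z k ω))) ∂P
        = ∫⁻ ω, a ω * ENNReal.ofReal (Real.exp (h n (F n ω, z n ω))) ∂P := by
          refine lintegral_congr fun ω => ?_
          rw [Finset.sum_range_succ, Real.exp_add, ENNReal.ofReal_mul (Real.exp_nonneg _)]
      _ = ∫⁻ p, p.1.1 * ENNReal.ofReal (Real.exp (h n (p.1.2, p.2)))
            ∂(P.map fun ω => ((a ω, F n ω), z n ω)) := by
          rw [lintegral_map hJ (hpair'.prodMk (hz n))]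
      _ = ∫⁻ p, ∫⁻ w, p.1 * ENNReal.ofReal (Real.exp (h n (p.2, w))) ∂ρ
            ∂(P.map fun ω => (a ω, F n ω)) := by
          rw [hmap, lintegral_prod _ hJ.aemeasurable]
      _ = ∫⁻ ω, ∫⁻ w, a ω * ENNReal.ofReal (Real.exp (h n (F n ω, w))) ∂ρ ∂P := by
          rw [lintegral_map hI hpair']
      _ ≤ ∫⁻ ω, a ω ∂P := by
          refine lintegral_mono fun ω => ?_
          have hGω : Measurable fun w => ENNReal.ofReal (Real.exp (h n (F n ω, w))) :=
            hG.comp measurable_prodMk_left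
          rw [lintegral_const_mul _ hGω]
          calc _ ≤ a ω * 1 := by gcongr; exact hle n ω
            _ = a ω := mul_one _
      _ ≤ 1 := ih

/-- Markov's inequality for finitely many exponential moments simultaneously. -/
lemma ofReal_one_sub_le_measure_forall_le {S : ℕ → Ω → ℝ} (hS : ∀ i, Measurable (S i)) {n : ℕ}
    (hn : 0 < n) (hle : ∀ i, ∫⁻ ω, ENNReal.ofReal (Real.exp (S i ω)) ∂P ≤ 1) {δ : ℝ} (hδ : 0 < δ) :
    ENNReal.ofReal (1 - δ) ≤ P {ω | ∀ i < n, S i ω ≤ Real.log (n / δ)} := by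
  have hn' : (0 : ℝ) < n := by exact_mod_cast hn
  have hms : MeasurableSet {ω | ∀ i < n, S i ω ≤ Real.log (n / δ)} := by
    simp only [Set.ofPred_forall]
    exact MeasurableSet.iInter fun i => MeasurableSet.iInter fun _ =>
      measurableSet_le (hS i) measurable_const
  have hbad : P {ω | ∀ i < n, S i ω ≤ Real.log (n / δ)}ᶜ ≤ ENNReal.ofReal δ := by
    calc P {ω | ∀ i < n, S i ω ≤ Real.log (n / δ)}ᶜ
        ≤ P (⋃ i ∈ Finset.range n, {ω | ENNReal.ofReal (n / δ) ≤
            ENNReal.ofReal (Real.exp (S i ω))}) := by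
          refine measure_mono fun ω hω => ?_
          simp only [Set.mem_compl_iff, Set.mem_ofPred_eq, not_forall, not_le] at hω
          obtain ⟨i, hi, h⟩ := hω
          simp only [Set.mem_iUnion, Finset.mem_range]
          refine ⟨i, hi, ENNReal.ofReal_le_ofReal ?_⟩
          exact ((Real.log_lt_iff_lt_exp (by positivity)).1 h).le
      _ ≤ ∑ i ∈ Finset.range n, P {ω | ENNReal.ofReal (n / δ) ≤
            ENNReal.ofReal (Real.exp (S i ω))} := measure_biUnion_finset_le _ _
      _ ≤ ∑ i ∈ Finset.range n, ENNReal.ofReal (δ / n) := by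
          refine Finset.sum_le_sum fun i _ => ?_
          refine (meas_ge_le_lintegral_div (ENNReal.measurable_ofReal.comp
            (Real.measurable_exp.comp (hS i))).aemeasurable ?_ ENNReal.ofReal_ne_top).trans ?_
          · simp; positivity
          · rw [← inv_div (n : ℝ) δ, ENNReal.ofReal_inv_of_pos (by positivity), ← one_div]
            gcongr
            exact hle i
      _ = ENNReal.ofReal δ := by
          rw [Finset.sum_const, Finset.card_range, nsmul_eq_mul, ← ENNReal.ofReal_natCast,
            ← ENNReal.ofReal_mul hn'.le, mul_div_cancel₀ _ hn'.ne']
  have h1 := prob_compl_eq_one_sub (μ := P) hms.compl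
  rw [compl_compl] at h1
  rw [h1, ENNReal.ofReal_sub _ hδ.le, ENNReal.ofReal_one]
  gcongr

end

/-! ### The abstract risk minimization problem -/

/-- Risk minimization over linear predictors `z ↦ ⟪f, Φ z⟫` in a Hilbert space, for a loss with
Hölder continuous and self-bounded derivative, together with a bounded minimizer `fH`. -/
structure OnlineProblem (Z H : Type*) [MeasurableSpace Z] [NormedAddCommGroup H]
    [InnerProductSpace ℝ H] [MeasurableSpace H] where
  ρ : Measure Z
  isProbabilityMeasure : IsProbabilityMeasure ρ
  φ : Z → ℝ → ℝ
  Φ : Z → H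
  (α L κ A B M : ℝ)
  fH : H
  holder : IsHolderLoss φ α L
  measurable_feature : Measurable Φ
  norm_feature_le : ∀ z, ‖Φ z‖ ≤ κ
  κ_nonneg : 0 ≤ κ
  A_nonneg : 0 ≤ A
  B_nonneg : 0 ≤ B
  M_nonneg : 0 ≤ M
  deriv_sq_le : ∀ z s, deriv (φ z) s ^ 2 ≤ A * φ z s + B
  loss_opt_le : ∀ z, φ z (inner ℝ fH (Φ z)) ≤ M
  integral_opt_le : ∀ f, ∫ z, φ z (inner ℝ fH (Φ z)) ∂ρ ≤ ∫ z, φ z (inner ℝ f (Φ z)) ∂ρ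

/-- The derivative of a Hölder loss in its second argument is jointly measurable. -/
lemma IsHolderLoss.measurable_deriv {Z : Type*} [MeasurableSpace Z] {φ : Z → ℝ → ℝ} {α L : ℝ}
    (h : IsHolderLoss φ α L) : Measurable fun q : Z × ℝ => deriv (φ q.1) q.2 := by
  have hφ := h.measurable
  -- The derivative is the pointwise limit of difference quotients along `1 / (n + 1)`.
  refine measurable_of_tendsto_metrizable (f := fun (n : ℕ) (q : Z × ℝ) =>
    ((1 : ℝ) / ((n : ℝ) + 1))⁻¹ * (φ q.1 (q.2 + 1 / ((n : ℝ) + 1)) - φ q.1 q.2)) (fun n => ?_) ?_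
  · have h' : Measurable fun q : Z × ℝ => φ q.1 (q.2 + 1 / ((n : ℝ) + 1)) :=
      hφ.comp (measurable_fst.prodMk (measurable_snd.add_const _))
    exact (h'.sub hφ).const_mul _
  · rw [tendsto_pi_nhds]
    intro q
    have h1 := (h.differentiable q.1 q.2).hasDerivAt.tendsto_slope_zero
    have h2 : Filter.Tendsto (fun n : ℕ => (1 : ℝ) / ((n : ℝ) + 1)) Filter.atTop
        (nhdsWithin 0 {0}ᶜ) := by
      rw [tendsto_nhdsWithin_iff]
      refine ⟨tendsto_one_div_add_atTop_nhds_zero_nat, Filter.Eventually.of_forall fun n => ?_⟩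
      have : (0 : ℝ) < 1 / ((n : ℝ) + 1) := by positivity
      exact this.ne'
    exact h1.comp h2

namespace OnlineProblem
noncomputable section
variable {Z H : Type*} [MeasurableSpace Z] [NormedAddCommGroup H] [InnerProductSpace ℝ H]
  [MeasurableSpace H] (p : OnlineProblem Z H)

instance : IsProbabilityMeasure p.ρ := p.isProbabilityMeasure

def loss (f : H) (z : Z) : ℝ := p.φ z (inner ℝ f (p.Φ z))

def dloss (f : H) (z : Z) : ℝ := deriv (p.φ z) (inner ℝ f (p.Φ z))

def grad (f : H) (z : Z) : H := p.dloss f z • p.Φ z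

def risk (f : H) : ℝ := ∫ z, p.loss f z ∂p.ρ

/-- The excess risk. -/
def gap (f : H) : ℝ := p.risk f - p.risk p.fH

def meanGrad (f : H) : H := ∫ z, p.grad f z ∂p.ρ

/-- A bound for the squared derivative of the loss at the minimizer. -/
def N : ℝ := p.A * p.M + p.B

/-- The factor 3 comes from squaring the three-term bound of `abs_dloss_le`. The leading 1 makes
division safe and lets the same constant dominate the power `1 + α` of a gradient norm below 1. -/
def gradBound (D : ℝ) : ℝ := 1 + 3 * p.κ ^ 2 * (p.N + p.L ^ 2 + p.L ^ 2 * p.κ ^ 2 * D)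

lemma N_nonneg : 0 ≤ p.N := add_nonneg (mul_nonneg p.A_nonneg p.M_nonneg) p.B_nonneg

lemma gap_nonneg (f : H) : 0 ≤ p.gap f := sub_nonneg.2 (p.integral_opt_le f)

lemma loss_nonneg (f : H) (z : Z) : 0 ≤ p.loss f z := p.holder.nonneg _ _

lemma dloss_sq_le (f : H) (z : Z) : p.dloss f z ^ 2 ≤ p.A * p.loss f z + p.B := p.deriv_sq_le _ _

lemma loss_fH_le (z : Z) : p.loss p.fH z ≤ p.M := p.loss_opt_le z

lemma dloss_fH_sq_le (z : Z) : p.dloss p.fH z ^ 2 ≤ p.N := by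
  have := mul_le_mul_of_nonneg_left (p.loss_fH_le z) p.A_nonneg
  exact (p.dloss_sq_le _ z).trans (by unfold N; linarith)

lemma abs_inner_feature_le (f : H) (z : Z) : |inner ℝ f (p.Φ z)| ≤ p.κ * ‖f‖ := by
  rw [mul_comm]
  exact (abs_real_inner_le_norm _ _).trans
    (mul_le_mul_of_nonneg_left (p.norm_feature_le z) (norm_nonneg _))

lemma abs_dloss_le (f : H) (z : Z) :
    |p.dloss f z| ≤ √p.N + p.L + p.L * p.κ * ‖f - p.fH‖ := by
  have hL := p.holder.L_pos
  have h1 : |p.dloss p.fH z| ≤ √p.N := Real.abs_le_sqrt (p.dloss_fH_sq_le z)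
  have h2 := p.holder.holder z (inner ℝ f (p.Φ z)) (inner ℝ p.fH (p.Φ z))
  rw [← inner_sub_left] at h2
  have h3 := p.abs_inner_feature_le (f - p.fH) z
  have h4 := Real.rpow_le_one_add_self (abs_nonneg (inner ℝ (f - p.fH) (p.Φ z)))
    p.holder.alpha_pos.le p.holder.alpha_le_one
  have h5 : p.L * |inner ℝ (f - p.fH) (p.Φ z)| ^ p.α ≤ p.L * (1 + p.κ * ‖f - p.fH‖) :=
    mul_le_mul_of_nonneg_left (by linarith) hL.le
  have h6 := abs_sub_abs_le_abs_sub (p.dloss f z) (p.dloss p.fH z)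
  change |p.dloss f z - p.dloss p.fH z| ≤ _ at h2
  nlinarith

lemma one_le_gradBound {D : ℝ} (hD : 0 ≤ D) : 1 ≤ p.gradBound D := by
  have := p.N_nonneg
  have : 0 ≤ 3 * p.κ ^ 2 * (p.N + p.L ^ 2 + p.L ^ 2 * p.κ ^ 2 * D) := by positivity
  unfold gradBound; linarith

lemma norm_grad_sq_le {f : H} {D : ℝ} (hD : ‖f - p.fH‖ ^ 2 ≤ D) (z : Z) :
    ‖p.grad f z‖ ^ 2 ≤ p.gradBound D := by
  have h1 := p.abs_dloss_le f z
  have hN := p.N_nonneg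
  have hκ := p.κ_nonneg
  have hL := p.holder.L_pos
  have h2 : p.dloss f z ^ 2 ≤ 3 * (p.N + p.L ^ 2 + p.L ^ 2 * p.κ ^ 2 * D) := by
    calc p.dloss f z ^ 2 = |p.dloss f z| ^ 2 := (sq_abs _).symm
      _ ≤ (√p.N + p.L + p.L * p.κ * ‖f - p.fH‖) ^ 2 := by gcongr
      _ ≤ 3 * (√p.N ^ 2 + p.L ^ 2 + (p.L * p.κ * ‖f - p.fH‖) ^ 2) := by
        nlinarith [sq_nonneg (√p.N - p.L), sq_nonneg (√p.N - p.L * p.κ * ‖f - p.fH‖),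
          sq_nonneg (p.L - p.L * p.κ * ‖f - p.fH‖)]
      _ = 3 * (p.N + p.L ^ 2 + p.L ^ 2 * p.κ ^ 2 * ‖f - p.fH‖ ^ 2) := by
        rw [Real.sq_sqrt hN]; ring
      _ ≤ _ := by gcongr
  calc ‖p.grad f z‖ ^ 2 = p.dloss f z ^ 2 * ‖p.Φ z‖ ^ 2 := by
        rw [grad, norm_smul, mul_pow, Real.norm_eq_abs, sq_abs]
    _ ≤ 3 * (p.N + p.L ^ 2 + p.L ^ 2 * p.κ ^ 2 * D) * p.κ ^ 2 := by
        gcongr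
        · exact (sq_nonneg _).trans h2
        · exact p.norm_feature_le z
    _ ≤ p.gradBound D := by unfold gradBound; linarith

lemma norm_grad_le_sqrt {f : H} {D : ℝ} (hD : ‖f - p.fH‖ ^ 2 ≤ D) (z : Z) :
    ‖p.grad f z‖ ≤ √(p.gradBound D) := by
  rw [← abs_of_nonneg (norm_nonneg (p.grad f z))]
  exact Real.abs_le_sqrt (p.norm_grad_sq_le hD z)

/-- Convexity of the loss along a difference of predictors. -/
lemma loss_sub_le (f g : H) (z : Z) :
    p.loss f z - p.loss g z ≤ p.dloss f z * inner ℝ (f - g) (p.Φ z) := by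
  have := deriv_mul_sub_le_of_convexOn (p.holder.differentiable z) (p.holder.convex z)
    (inner ℝ f (p.Φ z)) (inner ℝ g (p.Φ z))
  simp only [loss, dloss, inner_sub_left]
  linarith

lemma exists_loss_le (f : H) : ∃ C, ∀ z, p.loss f z ≤ C := by
  refine ⟨p.M + (√p.N + p.L + p.L * p.κ * ‖f - p.fH‖) * (p.κ * ‖f - p.fH‖), fun z => ?_⟩
  have h1 := p.loss_sub_le f p.fH z
  have h2 := p.loss_fH_le z
  have h3 : p.dloss f z * inner ℝ (f - p.fH) (p.Φ z) ≤
      (√p.N + p.L + p.L * p.κ * ‖f - p.fH‖) * (p.κ * ‖f - p.fH‖) := by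
    refine (le_abs_self _).trans ?_
    rw [abs_mul]
    exact mul_le_mul (p.abs_dloss_le f z) (p.abs_inner_feature_le _ z) (abs_nonneg _)
      ((abs_nonneg _).trans (p.abs_dloss_le f z))
  linarith

/-- Both derivatives obey the same affine bound in the loss at `f`. The square therefore grows only
linearly in that loss, which lets the drift absorb its mean. -/
lemma loss_sub_sq_le (f : H) (z : Z) :
    (p.loss p.fH z - p.loss f z) ^ 2 ≤
      p.κ ^ 2 * ‖f - p.fH‖ ^ 2 * (p.A * p.loss f z + p.N) := by
  have hb := p.loss_nonneg f z
  have hA := p.A_nonneg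
  have hM := p.M_nonneg
  have h0 : 0 ≤ p.A * p.loss f z + p.N := add_nonneg (mul_nonneg hA hb) p.N_nonneg
  have h1 : p.dloss f z ^ 2 ≤ p.A * p.loss f z + p.N := by
    refine (p.dloss_sq_le f z).trans ?_
    have := mul_nonneg hA hM
    unfold N; linarith
  have h2 : p.dloss p.fH z ^ 2 ≤ p.A * p.loss f z + p.N := by
    refine (p.dloss_fH_sq_le z).trans ?_
    have := mul_nonneg hA hb
    linarith
  calc (p.loss p.fH z - p.loss f z) ^ 2
      ≤ (inner ℝ p.fH (p.Φ z) - inner ℝ f (p.Φ z)) ^ 2 * (p.A * p.loss f z + p.N) :=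
        sq_sub_le_of_convexOn (p.holder.differentiable z) (p.holder.convex z) h1 h2
    _ = |inner ℝ (f - p.fH) (p.Φ z)| ^ 2 * (p.A * p.loss f z + p.N) := by
        rw [sq_abs, inner_sub_left]; ring
    _ ≤ (p.κ * ‖f - p.fH‖) ^ 2 * (p.A * p.loss f z + p.N) := by
        gcongr; exact p.abs_inner_feature_le _ z
    _ = _ := by ring

/-- One step of gradient descent. -/
lemma norm_step_sub_sq_le (f : H) (z : Z) {c : ℝ} (hc : 0 ≤ c) :
    ‖f - c • p.grad f z - p.fH‖ ^ 2 ≤ ‖f - p.fH‖ ^ 2 +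
      (2 * c - p.A * p.κ ^ 2 * c ^ 2) * (p.loss p.fH z - p.loss f z) + p.κ ^ 2 * p.N * c ^ 2 := by
  have hconv := p.loss_sub_le f p.fH z
  have hin : inner ℝ (f - p.fH) (p.grad f z) = p.dloss f z * inner ℝ (f - p.fH) (p.Φ z) := by
    rw [grad, inner_smul_right]
  -- Splitting `A * loss f` as `A * (loss f - loss fH) + A * loss fH` merges the squared gradient
  -- into the coefficient of the loss difference, leaving only `N`.
  have hfH := mul_le_mul_of_nonneg_left (p.loss_fH_le z) p.A_nonneg
  have hg : ‖p.grad f z‖ ^ 2 ≤ p.κ ^ 2 * (p.A * p.loss f z + p.B) := by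
    rw [grad, norm_smul, mul_pow, Real.norm_eq_abs, sq_abs, mul_comm (p.κ ^ 2)]
    exact mul_le_mul (p.dloss_sq_le f z)
      (pow_le_pow_left₀ (norm_nonneg _) (p.norm_feature_le z) 2) (sq_nonneg _)
      ((sq_nonneg _).trans (p.dloss_sq_le f z))
  have hexp : ‖f - c • p.grad f z - p.fH‖ ^ 2 =
      ‖f - p.fH‖ ^ 2 - 2 * c * inner ℝ (f - p.fH) (p.grad f z) + c ^ 2 * ‖p.grad f z‖ ^ 2 := by
    rw [show f - c • p.grad f z - p.fH = (f - p.fH) - c • p.grad f z by abel,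
      norm_sub_sq_real, inner_smul_right, norm_smul, mul_pow, Real.norm_eq_abs, sq_abs]
    ring
  rw [hexp, hin]
  have h1 := mul_le_mul_of_nonneg_left hg (sq_nonneg c)
  have h2 := mul_le_mul_of_nonneg_left hconv (mul_nonneg zero_le_two hc)
  have h3 := mul_le_mul_of_nonneg_left hfH (mul_nonneg (sq_nonneg c) (sq_nonneg p.κ))
  unfold N
  nlinarith

lemma norm_meanGrad_le {f : H} {D : ℝ} (hD : ‖f - p.fH‖ ^ 2 ≤ D) :
    ‖p.meanGrad f‖ ≤ √(p.gradBound D) := by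
  refine (norm_integral_le_of_norm_le_const (C := √(p.gradBound D))
    (Filter.Eventually.of_forall fun z => p.norm_grad_le_sqrt hD z)).trans (by simp)

/-! ### Integrability, second moments and smoothness of the risk -/

section Measurability
variable [BorelSpace H] [SecondCountableTopology H]

lemma measurable_inner_feature : Measurable fun q : H × Z => inner ℝ q.1 (p.Φ q.2) :=
  measurable_fst.inner (p.measurable_feature.comp measurable_snd)

lemma measurable_loss : Measurable fun q : H × Z => p.loss q.1 q.2 :=
  p.holder.measurable.comp (measurable_snd.prodMk p.measurable_inner_feature)

lemma measurable_dloss : Measurable fun q : H × Z => p.dloss q.1 q.2 :=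
  p.holder.measurable_deriv.comp (measurable_snd.prodMk p.measurable_inner_feature)

lemma measurable_grad : Measurable fun q : H × Z => p.grad q.1 q.2 :=
  p.measurable_dloss.smul (p.measurable_feature.comp measurable_snd)

lemma measurable_gap : Measurable p.gap := by
  have h : StronglyMeasurable fun q : H × Z => p.loss q.1 q.2 :=
    p.measurable_loss.stronglyMeasurable
  exact (h.integral_prod_right' (ν := p.ρ)).measurable.sub_const _

lemma measurable_meanGrad : Measurable p.meanGrad := by
  have h : StronglyMeasurable fun q : H × Z => p.grad q.1 q.2 :=
    p.measurable_grad.stronglyMeasurable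
  exact (h.integral_prod_right' (ν := p.ρ)).measurable

lemma integrable_loss (f : H) : Integrable (p.loss f) p.ρ := by
  obtain ⟨C, hC⟩ := p.exists_loss_le f
  refine Integrable.of_bound
    (p.measurable_loss.comp measurable_prodMk_left).aestronglyMeasurable C
    (Filter.Eventually.of_forall fun z => ?_)
  change ‖p.loss f z‖ ≤ C
  rw [Real.norm_eq_abs, abs_of_nonneg (p.loss_nonneg f z)]
  exact hC z

lemma integrable_grad (f : H) : Integrable (p.grad f) p.ρ :=
  Integrable.of_bound (p.measurable_grad.comp measurable_prodMk_left).aestronglyMeasurable _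
    (Filter.Eventually.of_forall fun z => p.norm_grad_le_sqrt le_rfl z)

lemma integral_loss_sub (f : H) : ∫ z, (p.loss p.fH z - p.loss f z) ∂p.ρ = -p.gap f := by
  rw [integral_sub (p.integrable_loss _) (p.integrable_loss _), gap, risk, risk]; ring

lemma integrable_loss_sub_sq (f : H) :
    Integrable (fun z => (p.loss p.fH z - p.loss f z) ^ 2) p.ρ := by
  refine Integrable.mono' (g := fun z =>
    p.κ ^ 2 * ‖f - p.fH‖ ^ 2 * (p.A * p.loss f z + p.N)) ?_ ?_ ?_
  · exact (((p.integrable_loss f).const_mul _).add (integrable_const _)).const_mul _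
  · exact ((p.integrable_loss _).sub (p.integrable_loss _)).aestronglyMeasurable.pow 2
  · refine Filter.Eventually.of_forall fun z => ?_
    rw [Real.norm_eq_abs, abs_of_nonneg (sq_nonneg _)]
    exact p.loss_sub_sq_le f z

lemma integral_loss_sub_sq_le (f : H) : ∫ z, (p.loss p.fH z - p.loss f z) ^ 2 ∂p.ρ ≤
    p.κ ^ 2 * ‖f - p.fH‖ ^ 2 * (p.A * p.gap f + 2 * p.N) := by
  have hi := (p.integrable_loss f).const_mul p.A
  have hM : p.risk p.fH ≤ p.M := by
    calc p.risk p.fH ≤ ∫ _, p.M ∂p.ρ :=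
          integral_mono (p.integrable_loss _) (integrable_const _) p.loss_fH_le
      _ = p.M := by simp
  have hAM := mul_le_mul_of_nonneg_left hM p.A_nonneg
  calc ∫ z, (p.loss p.fH z - p.loss f z) ^ 2 ∂p.ρ
      ≤ ∫ z, p.κ ^ 2 * ‖f - p.fH‖ ^ 2 * (p.A * p.loss f z + p.N) ∂p.ρ :=
        integral_mono (p.integrable_loss_sub_sq f) ((hi.add (integrable_const _)).const_mul _)
          (p.loss_sub_sq_le f)
    _ = p.κ ^ 2 * ‖f - p.fH‖ ^ 2 * (p.A * p.risk f + p.N) := by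
        rw [integral_const_mul, integral_add hi (integrable_const _), integral_const_mul]
        simp [risk]
    _ ≤ _ := by
        have hB := p.B_nonneg
        refine mul_le_mul_of_nonneg_left ?_ (by positivity)
        unfold gap N
        nlinarith

variable [CompleteSpace H]

/-- The risk decreases along the mean gradient, up to a Hölder remainder. -/
lemma gap_add_le (f h : H) : p.gap (f + h) ≤
    p.gap f + inner ℝ (p.meanGrad f) h + p.L * (p.κ * ‖h‖) ^ (1 + p.α) := by
  have hα := p.holder.alpha_pos
  have hL := p.holder.L_pos
  have hin : Integrable (fun z => inner ℝ h (p.grad f z)) p.ρ := (p.integrable_grad f).const_inner h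
  have hpt : ∀ z, p.loss (f + h) z ≤
      p.loss f z + inner ℝ h (p.grad f z) + p.L * (p.κ * ‖h‖) ^ (1 + p.α) := by
    intro z
    have h1 := taylor_le_of_holder_deriv hα hL (p.holder.differentiable z) (p.holder.holder z)
      (inner ℝ f (p.Φ z)) (inner ℝ (f + h) (p.Φ z))
    have h2 : inner ℝ (f + h) (p.Φ z) - inner ℝ f (p.Φ z) = inner ℝ h (p.Φ z) := by
      rw [inner_add_left]; ring
    rw [h2] at h1
    have h3 : p.L * |inner ℝ h (p.Φ z)| ^ (1 + p.α) ≤ p.L * (p.κ * ‖h‖) ^ (1 + p.α) := by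
      gcongr; exact p.abs_inner_feature_le h z
    have h4 : inner ℝ h (p.grad f z) = p.dloss f z * inner ℝ h (p.Φ z) := by
      rw [grad, inner_smul_right]
    rw [h4]
    unfold loss dloss
    linarith
  have hle := integral_mono (p.integrable_loss (f + h))
    (((p.integrable_loss f).add hin).add (integrable_const _)) hpt
  have heq : ∫ z, (p.loss f z + inner ℝ h (p.grad f z) + p.L * (p.κ * ‖h‖) ^ (1 + p.α)) ∂p.ρ =
      p.risk f + inner ℝ (p.meanGrad f) h + p.L * (p.κ * ‖h‖) ^ (1 + p.α) := by
    have hsum : Integrable (fun z => p.loss f z + inner ℝ h (p.grad f z)) p.ρ :=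
      (p.integrable_loss f).add hin
    rw [integral_add hsum (integrable_const _),
      integral_add (p.integrable_loss f) hin, integral_inner (p.integrable_grad f),
      real_inner_comm]
    simp [risk, meanGrad]
  have hle' : p.risk (f + h) ≤
      ∫ z, (p.loss f z + inner ℝ h (p.grad f z) + p.L * (p.κ * ‖h‖) ^ (1 + p.α)) ∂p.ρ := hle
  rw [heq] at hle'
  unfold gap
  linarith

end Measurability
end
end OnlineProblem

/-! ### The distance recursion of stochastic gradient descent -/

namespace OnlineProblem
noncomputable section
variable {Z H : Type*} [MeasurableSpace Z] [NormedAddCommGroup H] [InnerProductSpace ℝ H]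
  [MeasurableSpace H] (p : OnlineProblem Z H)

/-- Stochastic gradient descent started at `0`. -/
def sgd (γ : ℕ → ℝ) (w : ℕ → Z) : ℕ → H
  | 0 => 0
  | n + 1 => sgd γ w n - γ n • p.grad (sgd γ w n) (w n)

/-- Admissible step sizes. -/
structure IsStepSize (γ : ℕ → ℝ) : Prop where
  pos : ∀ n, 0 < γ n
  le : ∀ n, p.A * p.κ ^ 2 * γ n ≤ 1
  antitone : Antitone γ
  summable : Summable fun n => γ n ^ 2

variable {p} {γ : ℕ → ℝ}

/-- The effective step size `2 γ - A κ² γ²` of the distance recursion. -/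
def effStep (p : OnlineProblem Z H) (c : ℝ) : ℝ := 2 * c - p.A * p.κ ^ 2 * c ^ 2

lemma IsStepSize.le_effStep (hγ : p.IsStepSize γ) (n : ℕ) : γ n ≤ p.effStep (γ n) := by
  have := mul_le_mul_of_nonneg_right (hγ.le n) (hγ.pos n).le
  unfold effStep; linarith

lemma effStep_le (p : OnlineProblem Z H) (c : ℝ) : p.effStep c ≤ 2 * c := by
  have : 0 ≤ p.A * p.κ ^ 2 * c ^ 2 :=
    mul_nonneg (mul_nonneg p.A_nonneg (sq_nonneg _)) (sq_nonneg _)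
  unfold effStep; linarith

lemma IsStepSize.sum_sq_le (hγ : p.IsStepSize γ) (n : ℕ) :
    ∑ k ∈ Finset.range n, γ k ^ 2 ≤ ∑' k, γ k ^ 2 :=
  hγ.summable.sum_le_tsum _ fun _ _ => sq_nonneg _

lemma tsum_sq_nonneg (γ : ℕ → ℝ) : 0 ≤ ∑' k, γ k ^ 2 := tsum_nonneg fun _ => sq_nonneg _

/-- A deterministic bound for `γ n * ‖sgd n - fH‖ ^ 2`. -/
def stepDistBound (p : OnlineProblem Z H) (γ : ℕ → ℝ) : ℝ :=
  γ 0 * ‖p.fH‖ ^ 2 + 2 * p.M * (∑' k, γ k ^ 2) + γ 0 * (p.κ ^ 2 * p.N * ∑' k, γ k ^ 2)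

lemma norm_sgd_sub_sq_le (w : ℕ → Z) (hγ : p.IsStepSize γ) (n : ℕ) :
    ‖p.sgd γ w n - p.fH‖ ^ 2 ≤ ‖p.fH‖ ^ 2 + (∑ k ∈ Finset.range n,
      p.effStep (γ k) * (p.loss p.fH (w k) - p.loss (p.sgd γ w k) (w k))) +
      p.κ ^ 2 * p.N * ∑ k ∈ Finset.range n, γ k ^ 2 := by
  induction n with
  | zero => simp [sgd]
  | succ n ih =>
    have := p.norm_step_sub_sq_le (p.sgd γ w n) (w n) (hγ.pos n).le
    rw [Finset.sum_range_succ, Finset.sum_range_succ, sgd]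
    unfold effStep at ih ⊢
    linarith

/-- The loss differences are at most `M`, and monotone steps give `γ n * γ k ≤ γ k ^ 2` for `k < n`.
The bound holds on every path, so the exponential moments of the distance increments need no
truncation. -/
lemma mul_norm_sgd_sub_sq_le (w : ℕ → Z) (hγ : p.IsStepSize γ) (n : ℕ) :
    γ n * ‖p.sgd γ w n - p.fH‖ ^ 2 ≤ p.stepDistBound γ := by
  have hN := p.N_nonneg
  have hM := p.M_nonneg
  have hn := hγ.pos n
  have hn0 : γ n ≤ γ 0 := hγ.antitone (Nat.zero_le n)
  have hQ := hγ.sum_sq_le n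
  have hQ0 := tsum_sq_nonneg γ
  have h1 : ∑ k ∈ Finset.range n,
      p.effStep (γ k) * (p.loss p.fH (w k) - p.loss (p.sgd γ w k) (w k)) ≤
      ∑ k ∈ Finset.range n, 2 * γ k * p.M := by
    refine Finset.sum_le_sum fun k _ => ?_
    have h2 : p.loss p.fH (w k) - p.loss (p.sgd γ w k) (w k) ≤ p.M := by
      linarith [p.loss_fH_le (w k), p.loss_nonneg (p.sgd γ w k) (w k)]
    have h3 := (hγ.pos k).le.trans (hγ.le_effStep k)
    exact (mul_le_mul_of_nonneg_left h2 h3).trans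
      (mul_le_mul_of_nonneg_right (p.effStep_le _) hM)
  have h4 : γ n * ∑ k ∈ Finset.range n, 2 * γ k * p.M ≤ 2 * p.M * ∑' k, γ k ^ 2 := by
    calc γ n * ∑ k ∈ Finset.range n, 2 * γ k * p.M
        = 2 * p.M * ∑ k ∈ Finset.range n, γ n * γ k := by
          rw [Finset.mul_sum, Finset.mul_sum]
          exact Finset.sum_congr rfl fun k _ => by ring
      _ ≤ 2 * p.M * ∑ k ∈ Finset.range n, γ k ^ 2 := by
          gcongr with k hk
          rw [sq]
          exact mul_le_mul_of_nonneg_right (hγ.antitone (Finset.mem_range.1 hk).le) (hγ.pos k).le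
      _ ≤ _ := by gcongr
  have h5 : γ n * ‖p.fH‖ ^ 2 ≤ γ 0 * ‖p.fH‖ ^ 2 := by gcongr
  have h6 : γ n * (p.κ ^ 2 * p.N * ∑ k ∈ Finset.range n, γ k ^ 2) ≤
      γ 0 * (p.κ ^ 2 * p.N * ∑' k, γ k ^ 2) := by
    gcongr
    exact (hγ.pos 0).le
  have h7 := mul_le_mul_of_nonneg_left ((norm_sgd_sub_sq_le w hγ n).trans
    (add_le_add_left (add_le_add_right h1 _) _)) hn.le
  unfold stepDistBound
  linarith

/-- The exponent used for the distance recursion. -/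
def distRate (p : OnlineProblem Z H) (γ : ℕ → ℝ) : ℝ :=
  1 / (1 + 2 * γ 0 * p.M + 4 * p.stepDistBound γ * p.κ ^ 2 * p.A +
    16 * p.κ ^ 2 * p.N * ∑' k, γ k ^ 2)

lemma IsStepSize.stepDistBound_nonneg (hγ : p.IsStepSize γ) : 0 ≤ p.stepDistBound γ := by
  have := p.N_nonneg
  have := p.M_nonneg
  have := hγ.pos 0
  have := tsum_sq_nonneg γ
  unfold stepDistBound; positivity

/-- The three bounds respectively keep the exponent below 1, let half of the drift absorb the gap
part of the variance, and close the induction on distances. -/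
lemma IsStepSize.distRate_spec (hγ : p.IsStepSize γ) : 0 < p.distRate γ ∧
    p.distRate γ * (2 * γ 0 * p.M) ≤ 1 ∧
    p.distRate γ * (4 * p.stepDistBound γ * p.κ ^ 2 * p.A) ≤ 1 ∧
    p.distRate γ * (16 * p.κ ^ 2 * p.N * ∑' k, γ k ^ 2) ≤ 1 := by
  have h1 := p.N_nonneg
  have h2 := p.M_nonneg
  have h3 := hγ.pos 0
  have h4 := tsum_sq_nonneg γ
  have h5 := hγ.stepDistBound_nonneg
  have h6 := p.A_nonneg
  have a1 : 0 ≤ 2 * γ 0 * p.M := by positivity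
  have a2 : 0 ≤ 4 * p.stepDistBound γ * p.κ ^ 2 * p.A := by positivity
  have a3 : 0 ≤ 16 * p.κ ^ 2 * p.N * ∑' k, γ k ^ 2 := by positivity
  unfold distRate
  refine ⟨by positivity, ?_, ?_, ?_⟩ <;>
  · rw [one_div_mul_eq_div, div_le_one (by positivity)]
    linarith

/-- The exponent increments of the distance recursion. -/
def distIncr (p : OnlineProblem Z H) (γ : ℕ → ℝ) (k : ℕ) (q : H × Z) : ℝ :=
  p.distRate γ * (p.effStep (γ k) * (p.loss p.fH q.2 - p.loss q.1 q.2)) -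
    (-(p.distRate γ * p.effStep (γ k) * p.gap q.1 / 2) +
      8 * p.distRate γ ^ 2 * p.κ ^ 2 * p.N * γ k ^ 2 * ‖q.1 - p.fH‖ ^ 2)

/-- The radius constant of the distance recursion. -/
def radius (p : OnlineProblem Z H) (γ : ℕ → ℝ) : ℝ :=
  ‖p.fH‖ ^ 2 + p.κ ^ 2 * p.N * (∑' k, γ k ^ 2) + 1 / p.distRate γ

lemma IsStepSize.radius_pos (hγ : p.IsStepSize γ) : 0 < p.radius γ := by
  have := p.N_nonneg
  have := tsum_sq_nonneg γ
  have := hγ.distRate_spec.1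
  unfold radius; positivity

/-- Pathwise bounds for the distance to `fH` and the weighted cumulative excess risk. -/
lemma dist_and_sum_gap_le (w : ℕ → Z) (hγ : p.IsStepSize γ) {n : ℕ} {l : ℝ} (hl : 1 ≤ l)
    (h : ∀ m ≤ n, ∑ k ∈ Finset.range m, p.distIncr γ k (p.sgd γ w k, w k) ≤ l) :
    (∀ m ≤ n, ‖p.sgd γ w m - p.fH‖ ^ 2 ≤ 2 * p.radius γ * l) ∧
      ∑ k ∈ Finset.range n, γ k * p.gap (p.sgd γ w k) ≤ 4 * p.radius γ * l := by
  obtain ⟨hr, -, -, hr3⟩ := hγ.distRate_spec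
  set r := p.distRate γ with hr_def
  have hN := p.N_nonneg
  have hR := hγ.radius_pos
  -- The variance compensator involves only earlier distances. Assuming the claimed radius for
  -- these, it costs at most half of that radius.
  have main : ∀ m ≤ n, (∀ k < m, ‖p.sgd γ w k - p.fH‖ ^ 2 ≤ 2 * p.radius γ * l) →
      ‖p.sgd γ w m - p.fH‖ ^ 2 + (∑ k ∈ Finset.range m, γ k * p.gap (p.sgd γ w k)) / 2 ≤
        2 * p.radius γ * l := by
    intro m hm hk
    have h1 := norm_sgd_sub_sq_le w hγ m
    have h2 := h m hm
    have h3 : ∑ k ∈ Finset.range m, p.distIncr γ k (p.sgd γ w k, w k) =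
        r * ((∑ k ∈ Finset.range m,
          p.effStep (γ k) * (p.loss p.fH (w k) - p.loss (p.sgd γ w k) (w k))) +
        (∑ k ∈ Finset.range m, p.effStep (γ k) * p.gap (p.sgd γ w k)) / 2 -
        8 * r * p.κ ^ 2 * p.N * ∑ k ∈ Finset.range m, γ k ^ 2 * ‖p.sgd γ w k - p.fH‖ ^ 2) := by
      simp only [Finset.mul_sum, Finset.sum_div, ← Finset.sum_add_distrib,
        ← Finset.sum_sub_distrib]
      refine Finset.sum_congr rfl fun k _ => ?_
      simp only [distIncr, ← hr_def]
      ring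
    rw [h3, mul_comm, ← le_div_iff₀ hr] at h2
    have h4 : ∑ k ∈ Finset.range m, γ k * p.gap (p.sgd γ w k) ≤
        ∑ k ∈ Finset.range m, p.effStep (γ k) * p.gap (p.sgd γ w k) :=
      Finset.sum_le_sum fun k _ =>
        mul_le_mul_of_nonneg_right (hγ.le_effStep k) (p.gap_nonneg _)
    have h5 : ∑ k ∈ Finset.range m, γ k ^ 2 * ‖p.sgd γ w k - p.fH‖ ^ 2 ≤
        (∑' k, γ k ^ 2) * (2 * p.radius γ * l) := by
      calc _ ≤ ∑ k ∈ Finset.range m, γ k ^ 2 * (2 * p.radius γ * l) :=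
            Finset.sum_le_sum fun k hk' =>
              mul_le_mul_of_nonneg_left (hk k (Finset.mem_range.1 hk')) (sq_nonneg _)
        _ = (∑ k ∈ Finset.range m, γ k ^ 2) * (2 * p.radius γ * l) := by rw [Finset.sum_mul]
        _ ≤ _ := by gcongr; exact hγ.sum_sq_le m
    have h6 : 8 * r * p.κ ^ 2 * p.N *
        ∑ k ∈ Finset.range m, γ k ^ 2 * ‖p.sgd γ w k - p.fH‖ ^ 2 ≤ p.radius γ * l := by
      calc _ ≤ 8 * r * p.κ ^ 2 * p.N * ((∑' k, γ k ^ 2) * (2 * p.radius γ * l)) := by gcongr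
        _ = (r * (16 * p.κ ^ 2 * p.N * ∑' k, γ k ^ 2)) * (p.radius γ * l) := by ring
        _ ≤ 1 * (p.radius γ * l) := by gcongr
        _ = _ := one_mul _
    have h7 : p.κ ^ 2 * p.N * ∑ k ∈ Finset.range m, γ k ^ 2 ≤ p.κ ^ 2 * p.N * ∑' k, γ k ^ 2 := by
      gcongr; exact hγ.sum_sq_le m
    have h8 : ‖p.fH‖ ^ 2 + p.κ ^ 2 * p.N * (∑' k, γ k ^ 2) + l / r ≤ p.radius γ * l := by
      have hQ := tsum_sq_nonneg γ
      have : 0 ≤ ‖p.fH‖ ^ 2 + p.κ ^ 2 * p.N * (∑' k, γ k ^ 2) := by positivity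
      have h9 := mul_le_mul_of_nonneg_left hl this
      rw [radius, ← hr_def, add_mul, one_div_mul_eq_div]
      linarith
    linarith
  have hsum : ∀ m, 0 ≤ ∑ k ∈ Finset.range m, γ k * p.gap (p.sgd γ w k) := fun m =>
    Finset.sum_nonneg fun k _ => mul_nonneg (hγ.pos k).le (p.gap_nonneg _)
  have hdist : ∀ m, m ≤ n → ‖p.sgd γ w m - p.fH‖ ^ 2 ≤ 2 * p.radius γ * l := by
    intro m
    induction m using Nat.strong_induction_on with
    | _ m ih =>
      intro hm
      linarith [main m hm fun k hk => ih k hk (hk.le.trans hm), hsum m]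
  refine ⟨hdist, ?_⟩
  linarith [main n le_rfl fun k hk => hdist k hk.le, sq_nonneg ‖p.sgd γ w n - p.fH‖]

/-! ### Exponential moments of the increments and the last-iterate recursion -/

/-- Correlation of the stochastic gradient with its mean. -/
def gradCorr (p : OnlineProblem Z H) (f : H) (z : Z) : ℝ := inner ℝ (p.meanGrad f) (p.grad f z)

lemma abs_gradCorr_le {f : H} {D : ℝ} (hD : ‖f - p.fH‖ ^ 2 ≤ D) (z : Z) :
    |p.gradCorr f z| ≤ p.gradBound D := by
  have h1 := p.one_le_gradBound ((sq_nonneg _).trans hD)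
  calc |p.gradCorr f z| ≤ ‖p.meanGrad f‖ * ‖p.grad f z‖ := abs_real_inner_le_norm _ _
    _ ≤ √(p.gradBound D) * √(p.gradBound D) :=
        mul_le_mul (p.norm_meanGrad_le hD) (p.norm_grad_le_sqrt hD z) (norm_nonneg _)
          (Real.sqrt_nonneg _)
    _ = _ := Real.mul_self_sqrt (by linarith)

variable [BorelSpace H] [SecondCountableTopology H]

lemma measurable_distIncr (p : OnlineProblem Z H) (γ : ℕ → ℝ) (k : ℕ) :
    Measurable (p.distIncr γ k) := by
  have h1 : Measurable fun q : H × Z => p.loss p.fH q.2 :=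
    (p.measurable_loss.comp measurable_prodMk_left).comp measurable_snd
  have h2 : Measurable fun q : H × Z => p.gap q.1 := p.measurable_gap.comp measurable_fst
  have h3 : Measurable fun q : H × Z => ‖q.1 - p.fH‖ ^ 2 :=
    (measurable_fst.sub_const _).norm.pow_const 2
  exact (((h1.sub p.measurable_loss).const_mul _).const_mul _).sub
    (((h2.const_mul _).div_const _).neg.add (h3.const_mul _))

/-- The mean is `-(r * c * gap)`. In the second moment the term with `A * gap` costs at most half of
this by the hypothesis on `f`, and the term with `2 * N` is exactly what the compensator covers,
using `c ≤ 2 * γ k`. -/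
lemma lintegral_exp_distIncr_le_one (hγ : p.IsStepSize γ) (k : ℕ) {f : H}
    (hf : γ k * ‖f - p.fH‖ ^ 2 ≤ p.stepDistBound γ) :
    ∫⁻ z, ENNReal.ofReal (Real.exp (p.distIncr γ k (f, z))) ∂p.ρ ≤ 1 := by
  obtain ⟨hr, hr1, hr2, -⟩ := hγ.distRate_spec
  have hM := p.M_nonneg
  have hA := p.A_nonneg
  have hN := p.N_nonneg
  have hk := hγ.pos k
  have hc : 0 ≤ p.effStep (γ k) := hk.le.trans (hγ.le_effStep k)
  have hc2 := p.effStep_le (γ k)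
  have hk0 : γ k ≤ γ 0 := hγ.antitone (Nat.zero_le k)
  have hg := p.gap_nonneg f
  unfold distIncr
  dsimp only
  set r := p.distRate γ with hr_def
  set c := p.effStep (γ k) with hc_def
  have hint : Integrable (fun z => r * (c * (p.loss p.fH z - p.loss f z))) p.ρ :=
    ((((p.integrable_loss _).sub (p.integrable_loss _)).const_mul _).const_mul _)
  refine lintegral_exp_sub_le_one hint ?_ ?_ ?_
  · have h := (p.integrable_loss_sub_sq f).const_mul ((r * c) ^ 2)
    refine h.congr (Filter.Eventually.of_forall fun z => ?_)
    change (r * c) ^ 2 * (p.loss p.fH z - p.loss f z) ^ 2 = _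
    simp only []
    ring
  · intro z
    have h1 : p.loss p.fH z - p.loss f z ≤ p.M := by
      linarith [p.loss_fH_le z, p.loss_nonneg f z]
    calc r * (c * (p.loss p.fH z - p.loss f z)) ≤ r * (2 * γ 0 * p.M) := by
          refine mul_le_mul_of_nonneg_left ?_ hr.le
          exact (mul_le_mul_of_nonneg_left h1 hc).trans
            (mul_le_mul_of_nonneg_right (by linarith) hM)
      _ ≤ 1 := hr1
  · have e1 : ∫ z, r * (c * (p.loss p.fH z - p.loss f z)) ∂p.ρ = -(r * c * p.gap f) := by
      rw [integral_const_mul, integral_const_mul, p.integral_loss_sub]; ring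
    have e2 : ∫ z, (r * (c * (p.loss p.fH z - p.loss f z))) ^ 2 ∂p.ρ ≤
        (r * c) ^ 2 * (p.κ ^ 2 * ‖f - p.fH‖ ^ 2 * (p.A * p.gap f + 2 * p.N)) := by
      have : ∀ z, (r * (c * (p.loss p.fH z - p.loss f z))) ^ 2 =
          (r * c) ^ 2 * (p.loss p.fH z - p.loss f z) ^ 2 := fun z => by ring
      simp only [this]
      rw [integral_const_mul]
      exact mul_le_mul_of_nonneg_left (p.integral_loss_sub_sq_le f) (sq_nonneg _)
    have e3 : (r * c) ^ 2 * (p.κ ^ 2 * ‖f - p.fH‖ ^ 2 * (p.A * p.gap f)) ≤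
        r * c * p.gap f / 2 := by
      calc (r * c) ^ 2 * (p.κ ^ 2 * ‖f - p.fH‖ ^ 2 * (p.A * p.gap f))
          = r * c * p.gap f * (r * (c * ‖f - p.fH‖ ^ 2 * p.κ ^ 2 * p.A)) := by ring
        _ ≤ r * c * p.gap f * (r * (2 * p.stepDistBound γ * p.κ ^ 2 * p.A)) := by
            have : c * ‖f - p.fH‖ ^ 2 ≤ 2 * p.stepDistBound γ := by
              calc c * ‖f - p.fH‖ ^ 2 ≤ 2 * γ k * ‖f - p.fH‖ ^ 2 := by gcongr
                _ ≤ _ := by linarith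
            gcongr
        _ ≤ r * c * p.gap f * (1 / 2) := by
            refine mul_le_mul_of_nonneg_left ?_ (by positivity)
            linarith
        _ = _ := by ring
    have e4 : (r * c) ^ 2 * (p.κ ^ 2 * ‖f - p.fH‖ ^ 2 * (2 * p.N)) ≤
        8 * r ^ 2 * p.κ ^ 2 * p.N * γ k ^ 2 * ‖f - p.fH‖ ^ 2 := by
      calc _ ≤ (r * (2 * γ k)) ^ 2 * (p.κ ^ 2 * ‖f - p.fH‖ ^ 2 * (2 * p.N)) := by gcongr
        _ = _ := by ring
    rw [e1]
    linarith

lemma measurable_sgd {Ω : Type*} (p : OnlineProblem Z H) (γ : ℕ → ℝ) (z : ℕ → Ω → Z) (n : ℕ) :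
    Measurable[pastSigma z n] fun ω => p.sgd γ (fun t => z t ω) n := by
  induction n with
  | zero => exact measurable_const
  | succ n ih =>
    have h1 := ih.mono (pastSigma_mono n.le_succ) le_rfl
    have h2 := measurable_pastSigma (z := z) n.lt_succ_self
    have h3 : Measurable[pastSigma z (n + 1)] fun ω =>
        p.grad (p.sgd γ (fun t => z t ω) n) (z n ω) := p.measurable_grad.comp (h1.prodMk h2)
    exact h1.sub (h3.const_smul (γ n))

/-- The exponent increments for the correlation terms, with weight `b k ∈ [0, 1]`, normalized by
the gradient bound and truncated to a ball. -/
def corrIncr (p : OnlineProblem Z H) (b : ℕ → ℝ) (D : ℝ) (k : ℕ) (q : H × Z) : ℝ :=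
  Set.indicator {f : H | ‖f - p.fH‖ ^ 2 ≤ D} (fun _ => (1 : ℝ)) q.1 *
    (-(b k / p.gradBound D) * p.gradCorr q.1 q.2)

lemma measurable_gradCorr (p : OnlineProblem Z H) :
    Measurable fun q : H × Z => p.gradCorr q.1 q.2 :=
  (p.measurable_meanGrad.comp measurable_fst).inner p.measurable_grad

lemma measurable_corrIncr (p : OnlineProblem Z H) (b : ℕ → ℝ) (D : ℝ) (k : ℕ) :
    Measurable (p.corrIncr b D k) := by
  have hs : MeasurableSet {f : H | ‖f - p.fH‖ ^ 2 ≤ D} :=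
    measurableSet_le ((measurable_id.sub_const _).norm.pow_const 2) measurable_const
  exact ((measurable_const.indicator hs).comp measurable_fst).mul
    (p.measurable_gradCorr.const_mul _)

/-- Inside the ball the correlation has mean `‖meanGrad‖ ^ 2` and second moment at most `G` times
that. With weight `b / G` and `b ≤ 1` the negative drift dominates, so no compensator is needed;
outside, the exponent vanishes. -/
lemma lintegral_exp_corrIncr_le_one [CompleteSpace H] (p : OnlineProblem Z H) {b : ℕ → ℝ}
    (hb0 : ∀ k, 0 ≤ b k) (hb1 : ∀ k, b k ≤ 1) (D : ℝ) (k : ℕ) (f : H) :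
    ∫⁻ z, ENNReal.ofReal (Real.exp (p.corrIncr b D k (f, z))) ∂p.ρ ≤ 1 := by
  by_cases hD : ‖f - p.fH‖ ^ 2 ≤ D
  swap
  · have : ∀ z, p.corrIncr b D k (f, z) = 0 := fun z => by simp [corrIncr, hD]
    simp [this]
  set G := p.gradBound D with hG
  have hG1 : 1 ≤ G := p.one_le_gradBound ((sq_nonneg _).trans hD)
  have hG0 : 0 < G := by linarith
  have h0 : ∀ z, p.corrIncr b D k (f, z) = -(b k / G) * p.gradCorr f z - 0 := fun z => by
    simp [corrIncr, hD, ← hG]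
  simp only [h0]
  have hint : Integrable (p.gradCorr f) p.ρ := (p.integrable_grad f).const_inner _
  have hmean : ∫ z, p.gradCorr f z ∂p.ρ = ‖p.meanGrad f‖ ^ 2 := by
    have h := integral_inner (𝕜 := ℝ) (p.integrable_grad f) (p.meanGrad f)
    rw [← real_inner_self_eq_norm_sq]
    exact h
  have hsq : ∀ z, p.gradCorr f z ^ 2 ≤ ‖p.meanGrad f‖ ^ 2 * G := fun z => by
    calc p.gradCorr f z ^ 2 = |p.gradCorr f z| ^ 2 := (sq_abs _).symm
      _ ≤ (‖p.meanGrad f‖ * ‖p.grad f z‖) ^ 2 := by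
          gcongr; exact abs_real_inner_le_norm _ _
      _ = ‖p.meanGrad f‖ ^ 2 * ‖p.grad f z‖ ^ 2 := by ring
      _ ≤ _ := by gcongr; exact p.norm_grad_sq_le hD z
  have hint2 : Integrable (fun z => p.gradCorr f z ^ 2) p.ρ := by
    refine Integrable.of_bound (hint.aestronglyMeasurable.pow 2) (‖p.meanGrad f‖ ^ 2 * G)
      (Filter.Eventually.of_forall fun z => ?_)
    rw [Real.norm_eq_abs, abs_of_nonneg (sq_nonneg _)]
    exact hsq z
  have hmean2 : ∫ z, p.gradCorr f z ^ 2 ∂p.ρ ≤ ‖p.meanGrad f‖ ^ 2 * G := by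
    calc _ ≤ ∫ _, ‖p.meanGrad f‖ ^ 2 * G ∂p.ρ := integral_mono hint2 (integrable_const _) hsq
      _ = _ := by simp
  have hbG : 0 ≤ b k / G := div_nonneg (hb0 k) hG0.le
  refine lintegral_exp_sub_le_one (hint.const_mul _) ?_ ?_ ?_
  · simp only [mul_pow]
    exact hint2.const_mul _
  · intro z
    have h1 := neg_le_of_abs_le (abs_gradCorr_le hD z)
    calc -(b k / G) * p.gradCorr f z = b k / G * (-p.gradCorr f z) := by ring
      _ ≤ b k / G * G := by gcongr; linarith
      _ = b k := div_mul_cancel₀ _ hG0.ne'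
      _ ≤ 1 := hb1 k
  · simp only [mul_pow]
    rw [integral_const_mul, integral_const_mul, hmean]
    have h1 : (-(b k / G)) ^ 2 * ∫ z, p.gradCorr f z ^ 2 ∂p.ρ ≤
        (-(b k / G)) ^ 2 * (‖p.meanGrad f‖ ^ 2 * G) :=
      mul_le_mul_of_nonneg_left hmean2 (sq_nonneg _)
    have h2 : (-(b k / G)) ^ 2 * (‖p.meanGrad f‖ ^ 2 * G) =
        b k * (b k / G * ‖p.meanGrad f‖ ^ 2) := by field_simp
    have h3 : b k * (b k / G * ‖p.meanGrad f‖ ^ 2) ≤ 1 * (b k / G * ‖p.meanGrad f‖ ^ 2) := by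
      gcongr; exact hb1 k
    linarith

/-- Last-iterate bound through a weighted average of the excess risks of the previous iterates. -/
lemma sum_mul_gap_sgd_le [CompleteSpace H] (w : ℕ → Z) (hγ : p.IsStepSize γ) {D : ℝ} {a n : ℕ}
    (han : a ≤ n) (hD : ∀ k < n, ‖p.sgd γ w k - p.fH‖ ^ 2 ≤ D) :
    (∑ k ∈ Finset.Ico a n, γ k) * p.gap (p.sgd γ w n) ≤
      (∑ k ∈ Finset.Ico a n, γ k * p.gap (p.sgd γ w k)) +
      ∑ k ∈ Finset.Ico a n, (∑ j ∈ Finset.Ico a (k + 1), γ j) *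
        (-(γ k * p.gradCorr (p.sgd γ w k) (w k)) +
          p.L * p.κ ^ (1 + p.α) * p.gradBound D * γ k ^ (1 + p.α)) := by
  have hα := p.holder.alpha_pos
  have hα1 := p.holder.alpha_le_one
  have hL := p.holder.L_pos
  have hκ := p.κ_nonneg
  induction n, han using Nat.le_induction with
  | base => simp
  | succ n han ih =>
    have ih := ih fun k hk => hD k (by omega)
    have hDn := hD n n.lt_succ_self
    set f := p.sgd γ w n with hf
    have hγn := hγ.pos n
    have h1 : p.gap (p.sgd γ w (n + 1)) ≤ p.gap f + (-(γ n * p.gradCorr f (w n)) +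
        p.L * p.κ ^ (1 + p.α) * p.gradBound D * γ n ^ (1 + p.α)) := by
      have h2 := p.gap_add_le f (-(γ n • p.grad f (w n)))
      rw [inner_neg_right, inner_smul_right, norm_neg, norm_smul, Real.norm_eq_abs,
        abs_of_pos hγn] at h2
      have h3 : p.sgd γ w (n + 1) = f + -(γ n • p.grad f (w n)) := by
        rw [← sub_eq_add_neg]; rfl
      have h4 : ‖p.grad f (w n)‖ ^ (1 + p.α) ≤ p.gradBound D := by
        have hG1 := p.one_le_gradBound ((sq_nonneg _).trans hDn)
        rcases le_total ‖p.grad f (w n)‖ 1 with h | h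
        · exact (Real.rpow_le_one (norm_nonneg _) h (by linarith)).trans hG1
        · calc ‖p.grad f (w n)‖ ^ (1 + p.α) ≤ ‖p.grad f (w n)‖ ^ (2 : ℝ) :=
                Real.rpow_le_rpow_of_exponent_le h (by linarith)
            _ = ‖p.grad f (w n)‖ ^ 2 := by norm_cast
            _ ≤ _ := p.norm_grad_sq_le hDn _
      have h5 : p.L * (p.κ * (γ n * ‖p.grad f (w n)‖)) ^ (1 + p.α) ≤
          p.L * p.κ ^ (1 + p.α) * p.gradBound D * γ n ^ (1 + p.α) := by
        rw [Real.mul_rpow hκ (by positivity), Real.mul_rpow hγn.le (norm_nonneg _)]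
        calc _ = p.L * p.κ ^ (1 + p.α) * ‖p.grad f (w n)‖ ^ (1 + p.α) * γ n ^ (1 + p.α) := by ring
          _ ≤ _ := by gcongr
      rw [h3]
      unfold gradCorr
      linarith
    -- The one-step bound is multiplied by the partial sum up to `n`; its last summand `γ n`
    -- produces the new term `γ n * gap f`.
    have hV : 0 ≤ ∑ j ∈ Finset.Ico a (n + 1), γ j := Finset.sum_nonneg fun k _ => (hγ.pos k).le
    have h6 := mul_le_mul_of_nonneg_left h1 hV
    rw [Finset.sum_Ico_succ_top han (fun k => γ k * p.gap (p.sgd γ w k)),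
      Finset.sum_Ico_succ_top han (fun k => (∑ j ∈ Finset.Ico a (k + 1), γ j) * _)]
    have h7 : (∑ j ∈ Finset.Ico a (n + 1), γ j) * p.gap f =
        (∑ j ∈ Finset.Ico a n, γ j) * p.gap f + γ n * p.gap f := by
      rw [Finset.sum_Ico_succ_top han, add_mul]
    rw [← hf]
    linarith

end
end OnlineProblem

/-! ### The high-probability bound for the last iterate -/

namespace OnlineProblem
noncomputable section
variable {Z H : Type*} [MeasurableSpace Z] [NormedAddCommGroup H] [InnerProductSpace ℝ H]
  [MeasurableSpace H] {p : OnlineProblem Z H} {γ : ℕ → ℝ}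

/-- Normalized weights of the correlation terms on the window `[a, n)`. -/
def windowWeight (γ : ℕ → ℝ) (a n k : ℕ) : ℝ :=
  if k ∈ Finset.Ico a n then
    (∑ j ∈ Finset.Ico a (k + 1), γ j) * γ k / ((∑ j ∈ Finset.Ico a n, γ j) * γ a) else 0

lemma IsStepSize.sum_Ico_pos (hγ : p.IsStepSize γ) {a n : ℕ} (han : a < n) :
    0 < ∑ j ∈ Finset.Ico a n, γ j :=
  Finset.sum_pos (fun k _ => hγ.pos k) (Finset.nonempty_Ico.2 han)

lemma IsStepSize.sum_Ico_succ_le (hγ : p.IsStepSize γ) {a n k : ℕ} (hk : k ∈ Finset.Ico a n) :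
    ∑ j ∈ Finset.Ico a (k + 1), γ j ≤ ∑ j ∈ Finset.Ico a n, γ j :=
  Finset.sum_le_sum_of_subset_of_nonneg
    (Finset.Ico_subset_Ico_right (Finset.mem_Ico.1 hk).2) fun j _ _ => (hγ.pos j).le

lemma IsStepSize.windowWeight_mem (hγ : p.IsStepSize γ) {a n : ℕ} (han : a < n) (k : ℕ) :
    0 ≤ windowWeight γ a n k ∧ windowWeight γ a n k ≤ 1 := by
  unfold windowWeight
  split_ifs with hk
  · have hS := hγ.sum_Ico_pos han
    have ha := hγ.pos a
    have h0 : 0 ≤ ∑ j ∈ Finset.Ico a (k + 1), γ j := Finset.sum_nonneg fun j _ => (hγ.pos j).le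
    refine ⟨div_nonneg (mul_nonneg h0 (hγ.pos k).le) (mul_pos hS ha).le, ?_⟩
    rw [div_le_one (mul_pos hS ha)]
    exact mul_le_mul (hγ.sum_Ico_succ_le hk) (hγ.antitone (Finset.mem_Ico.1 hk).1)
      (hγ.pos k).le hS.le
  · simp

/-- The gradient bound is affine in `D` with nonnegative constant term. This is the source of the
second factor `l` in the final estimate. -/
lemma gradBound_mul_le (p : OnlineProblem Z H) {D l : ℝ} (hl : 1 ≤ l) :
    p.gradBound (D * l) ≤ p.gradBound D * l := by
  have hN := p.N_nonneg
  have h : 0 ≤ 1 + 3 * p.κ ^ 2 * (p.N + p.L ^ 2) := by positivity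
  have := mul_le_mul_of_nonneg_left hl h
  unfold gradBound
  linarith

/-- The constant of the excess risk bound. -/
def gapConst (p : OnlineProblem Z H) (γ : ℕ → ℝ) : ℝ :=
  4 * p.radius γ + p.gradBound (2 * p.radius γ) * (1 + γ 0) +
    p.L * p.κ ^ (1 + p.α) * p.gradBound (2 * p.radius γ)

variable [BorelSpace H] [SecondCountableTopology H] [CompleteSpace H]

/-- Pathwise excess risk bound for the last iterate. -/
lemma gap_sgd_le (w : ℕ → Z) (hγ : p.IsStepSize γ) {a n : ℕ} (han : a < n) {l : ℝ} (hl : 1 ≤ l)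
    (hdist : ∀ m ≤ n, ∑ k ∈ Finset.range m, p.distIncr γ k (p.sgd γ w k, w k) ≤ l)
    (hcorr : ∑ k ∈ Finset.range n, p.corrIncr (windowWeight γ a n) (2 * p.radius γ * l) k
      (p.sgd γ w k, w k) ≤ l) :
    p.gap (p.sgd γ w n) ≤ p.gapConst γ *
      max (max (∑ k ∈ Finset.Ico a n, γ k)⁻¹ (γ a ^ p.α))
        (∑ k ∈ Finset.Ico a n, γ k ^ (1 + p.α)) * l ^ 2 := by
  obtain ⟨hD, hsum⟩ := dist_and_sum_gap_le w hγ hl hdist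
  have hR := hγ.radius_pos
  have hα := p.holder.alpha_pos
  have hα1 := p.holder.alpha_le_one
  have hL := p.holder.L_pos
  have hκ := p.κ_nonneg
  have ha := hγ.pos a
  have hS := hγ.sum_Ico_pos han
  set S := ∑ k ∈ Finset.Ico a n, γ k with hS_def
  set D := 2 * p.radius γ * l with hD_def
  set G := p.gradBound D with hG_def
  set G₂ := p.gradBound (2 * p.radius γ) with hG₂_def
  set E := ∑ k ∈ Finset.Ico a n, γ k ^ (1 + p.α) with hE_def
  set cL := p.L * p.κ ^ (1 + p.α) with hcL_def
  have hcL : 0 ≤ cL := by positivity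
  have hG1 : 1 ≤ G := p.one_le_gradBound (by positivity)
  have hG0 : 0 < G := by linarith
  have hGG : G ≤ G₂ * l := p.gradBound_mul_le hl
  have hG₂ : 1 ≤ G₂ := p.one_le_gradBound (by positivity)
  have hE : 0 ≤ E := Finset.sum_nonneg fun k _ => Real.rpow_nonneg (hγ.pos k).le _
  have hlast := sum_mul_gap_sgd_le w hγ han.le fun k hk => hD k hk.le
  have hwin : ∑ k ∈ Finset.Ico a n, γ k * p.gap (p.sgd γ w k) ≤ 4 * p.radius γ * l := by
    refine le_trans (Finset.sum_le_sum_of_subset_of_nonneg ?_ ?_) hsum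
    · intro k hk; exact Finset.mem_range.2 (Finset.mem_Ico.1 hk).2
    · intro k _ _; exact mul_nonneg (hγ.pos k).le (p.gap_nonneg _)
  have hcorr' : ∑ k ∈ Finset.Ico a n, (∑ j ∈ Finset.Ico a (k + 1), γ j) *
      (-(γ k * p.gradCorr (p.sgd γ w k) (w k))) ≤ S * (γ a * G * l) := by
    have h1 : ∑ k ∈ Finset.range n, p.corrIncr (windowWeight γ a n) D k (p.sgd γ w k, w k) =
        (∑ k ∈ Finset.Ico a n, (∑ j ∈ Finset.Ico a (k + 1), γ j) *
          (-(γ k * p.gradCorr (p.sgd γ w k) (w k)))) / (S * γ a * G) := by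
      have hsub : Finset.Ico a n ⊆ Finset.range n := fun k hk =>
        Finset.mem_range.2 (Finset.mem_Ico.1 hk).2
      rw [← Finset.sum_subset hsub, Finset.sum_div]
      · refine Finset.sum_congr rfl fun k hk => ?_
        have h2 : ‖p.sgd γ w k - p.fH‖ ^ 2 ≤ D := hD k (Finset.mem_Ico.1 hk).2.le
        -- The distance bound on this path makes the truncation inactive.
        rw [corrIncr, windowWeight, if_pos hk, Set.indicator_of_mem (by exact h2), ← hS_def,
          ← hG_def]
        field_simp
      · intro k _ hk
        simp [corrIncr, windowWeight, hk]
    rw [h1, div_le_iff₀ (by positivity)] at hcorr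
    linarith
  have hrem : ∑ k ∈ Finset.Ico a n, (∑ j ∈ Finset.Ico a (k + 1), γ j) *
      (cL * G * γ k ^ (1 + p.α)) ≤ S * (cL * G * E) := by
    rw [hE_def, Finset.mul_sum, Finset.mul_sum]
    refine Finset.sum_le_sum fun k hk => ?_
    have := Real.rpow_nonneg (hγ.pos k).le (1 + p.α)
    exact mul_le_mul_of_nonneg_right (hγ.sum_Ico_succ_le hk) (by positivity)
  have htot : S * p.gap (p.sgd γ w n) ≤
      4 * p.radius γ * l + (S * (γ a * G * l) + S * (cL * G * E)) := by
    refine hlast.trans (add_le_add hwin ?_)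
    simp only [mul_add, Finset.sum_add_distrib]
    exact add_le_add hcorr' hrem
  have hgap : p.gap (p.sgd γ w n) ≤ 4 * p.radius γ * l * S⁻¹ + γ a * G * l + cL * G * E := by
    rw [← mul_le_mul_iff_right₀ hS]
    refine htot.trans (le_of_eq ?_)
    field_simp
    ring
  set m := max (max S⁻¹ (γ a ^ p.α)) E with hm_def
  have hm1 : S⁻¹ ≤ m := (le_max_left _ _).trans (le_max_left _ _)
  have hm2 : γ a ^ p.α ≤ m := (le_max_right _ _).trans (le_max_left _ _)
  have hm3 : E ≤ m := le_max_right _ _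
  have hm0 : 0 ≤ m := hE.trans hm3
  have hl0 : 0 ≤ l := by linarith
  have hll : l ≤ l ^ 2 := by nlinarith
  -- The correlation error is of order `γ a`; as `γ a ≤ γ 0`, it is controlled by `γ a ^ α` since `α
  -- ≤ 1`.
  have hγa : γ a ≤ (1 + γ 0) * m := by
    calc γ a = γ a ^ (1 - p.α) * γ a ^ p.α := by
          rw [← Real.rpow_add ha]; simp
      _ ≤ (1 + γ 0) * m := by
          have h1 := Real.rpow_le_one_add_self ha.le (sub_nonneg.2 hα1) (by linarith)
          have h2 := hγ.antitone (Nat.zero_le a)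
          have h3 := hγ.pos 0
          exact mul_le_mul (by linarith) hm2 (Real.rpow_nonneg ha.le _) (by linarith)
  have b1 : 4 * p.radius γ * l * S⁻¹ ≤ 4 * p.radius γ * m * l ^ 2 := by
    calc 4 * p.radius γ * l * S⁻¹ ≤ 4 * p.radius γ * l ^ 2 * m := by gcongr
      _ = _ := by ring
  have b2 : γ a * G * l ≤ G₂ * (1 + γ 0) * m * l ^ 2 := by
    have h3 := hγ.pos 0
    calc γ a * G * l ≤ ((1 + γ 0) * m) * (G₂ * l) * l := by gcongr
      _ = _ := by ring
  have b3 : cL * G * E ≤ cL * G₂ * m * l ^ 2 := by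
    calc cL * G * E ≤ cL * (G₂ * l ^ 2) * m := by
          gcongr
          exact hGG.trans (by gcongr)
      _ = _ := by ring
  have hC : p.gapConst γ * m * l ^ 2 = 4 * p.radius γ * m * l ^ 2 + G₂ * (1 + γ 0) * m * l ^ 2 +
      cL * G₂ * m * l ^ 2 := by
    unfold gapConst; ring
  linarith

/-- High-probability excess risk bound for the last iterate of stochastic gradient descent. -/
theorem ofReal_one_sub_le_measure_gap_sgd_le (hγ : p.IsStepSize γ) {Ω : Type*} [MeasurableSpace Ω]
    {P : Measure Ω} [IsProbabilityMeasure P] {z : ℕ → Ω → Z} (hz : ∀ i, Measurable (z i))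
    (hind : iIndepFun z P) (hlaw : ∀ i, P.map (z i) = p.ρ) {a n : ℕ} (han : a < n) {δ : ℝ}
    (hδ : 0 < δ) (hδ1 : δ < 1) :
    ENNReal.ofReal (1 - δ) ≤ P {ω | p.gap (p.sgd γ (fun t => z t ω) n) ≤ p.gapConst γ *
      max (max (∑ k ∈ Finset.Ico a n, γ k)⁻¹ (γ a ^ p.α))
        (∑ k ∈ Finset.Ico a n, γ k ^ (1 + p.α)) * Real.log (3 * n / δ) ^ 2} := by
  have hn1 : (1 : ℝ) ≤ n := by exact_mod_cast (Nat.one_le_iff_ne_zero.2 (by omega))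
  set l := Real.log (3 * n / δ) with hl_def
  -- The union bound involves `n + 2` exponents, and `n + 2 ≤ 3 * n`.
  have hlle : Real.log ((n + 2 : ℕ) / δ) ≤ l := by
    apply Real.log_le_log (by positivity)
    push_cast
    gcongr
    linarith
  have hl : 1 ≤ l := by
    rw [hl_def, Real.le_log_iff_exp_le (by positivity), le_div_iff₀ hδ]
    have := Real.exp_one_lt_d9
    have := Real.exp_pos 1
    nlinarith
  set F : ℕ → Ω → H := fun k ω => p.sgd γ (fun t => z t ω) k with hF_def
  have hF : ∀ k, Measurable[pastSigma z k] (F k) := fun k => p.measurable_sgd γ z k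
  have hF' : ∀ k, Measurable (F k) := fun k => (hF k).mono (pastSigma_le hz k) le_rfl
  set h₂ := p.corrIncr (windowWeight γ a n) (2 * p.radius γ * l) with h₂_def
  -- Indices `0, …, n` carry the partial distance sums, all needed by the induction on distances;
  -- index `n + 1` carries the correlation sum.
  let S : ℕ → Ω → ℝ := fun i ω =>
    if i ≤ n then ∑ k ∈ Finset.range i, p.distIncr γ k (F k ω, z k ω)
    else ∑ k ∈ Finset.range n, h₂ k (F k ω, z k ω)
  have hS : ∀ i, Measurable (S i) := by
    intro i
    by_cases hi : i ≤ n
    · simp only [S, if_pos hi]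
      exact Finset.measurable_sum _ fun k _ =>
        (p.measurable_distIncr γ k).comp ((hF' k).prodMk (hz k))
    · simp only [S, if_neg hi]
      exact Finset.measurable_sum _ fun k _ =>
        (p.measurable_corrIncr _ _ k).comp ((hF' k).prodMk (hz k))
  have hle : ∀ i, ∫⁻ ω, ENNReal.ofReal (Real.exp (S i ω)) ∂P ≤ 1 := by
    intro i
    by_cases hi : i ≤ n
    · simp only [S, if_pos hi]
      exact lintegral_exp_sum_le_one hz hind hlaw hF (fun k => p.measurable_distIncr γ k)
        (fun k ω => lintegral_exp_distIncr_le_one hγ k (mul_norm_sgd_sub_sq_le _ hγ k)) i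
    · simp only [S, if_neg hi]
      exact lintegral_exp_sum_le_one hz hind hlaw hF (fun k => p.measurable_corrIncr _ _ k)
        (fun k ω => p.lintegral_exp_corrIncr_le_one (fun k => (hγ.windowWeight_mem han k).1)
          (fun k => (hγ.windowWeight_mem han k).2) _ k _) n
  refine (ofReal_one_sub_le_measure_forall_le hS (n := n + 2) (by omega) hle hδ).trans
    (measure_mono fun ω hω => ?_)
  refine gap_sgd_le (fun t => z t ω) hγ han hl (fun m hm => ?_) ?_
  · have := hω m (by omega)
    simp only [S, if_pos hm] at this
    exact this.trans hlle
  · have := hω (n + 1) (by omega)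
    simp only [S, if_neg (show ¬ n + 1 ≤ n by omega)] at this
    exact this.trans hlle

end
end OnlineProblem

/-! ### Kernel sections and reduction to the abstract problem -/

section
variable {X : Type*} {H : Type*} [NormedAddCommGroup H] [InnerProductSpace ℝ H] [CompleteSpace H]
  [RKHS ℝ H X ℝ]

lemma inner_kernelSection (f : H) (x : X) : inner ℝ f (kernelSection H x) = f x := by
  simp [kernelSection]

lemma norm_kernelSection_sq {K : X → X → ℝ} (hH : IsRKHSOf H K) (x : X) :
    ‖kernelSection H x‖ ^ 2 = K x x := by
  rw [← real_inner_self_eq_norm_sq, inner_kernelSection, hH]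

lemma norm_kernelSection_le {K : X → X → ℝ} (hH : IsRKHSOf H K)
    (hκ : BddAbove (Set.range fun x : X => √(K x x))) (x : X) :
    ‖kernelSection H x‖ ≤ kernelSup K := by
  have h : ‖kernelSection H x‖ = √(K x x) := by
    rw [← norm_kernelSection_sq hH, Real.sqrt_sq (norm_nonneg _)]
  rw [h]
  exact le_ciSup hκ x

lemma continuous_kernelSection [TopologicalSpace X] {K : X → X → ℝ} (hK : IsMercerKernel K)
    (hH : IsRKHSOf H K) : Continuous (kernelSection H : X → H) := by
  rw [continuous_iff_continuousAt]
  intro x₀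
  have h : ∀ x, ‖kernelSection H x - kernelSection H x₀‖ = √(K x x - 2 * K x x₀ + K x₀ x₀) := by
    intro x
    rw [← Real.sqrt_sq (norm_nonneg (kernelSection H x - kernelSection H x₀)), norm_sub_sq_real,
      norm_kernelSection_sq hH, norm_kernelSection_sq hH, inner_kernelSection, hH]
  rw [ContinuousAt, tendsto_iff_norm_sub_tendsto_zero]
  simp only [h]
  have hc := hK.continuous
  have h1 : Continuous fun x => √(K x x - 2 * K x x₀ + K x₀ x₀) := by
    have h2 : Continuous fun x => K x x := hc.comp (continuous_id.prodMk continuous_id)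
    have h3 : Continuous fun x => K x x₀ := hc.comp (continuous_id.prodMk continuous_const)
    fun_prop
  convert h1.tendsto x₀ using 2
  rw [show K x₀ x₀ - 2 * K x₀ x₀ + K x₀ x₀ = 0 by ring, Real.sqrt_zero]

/-- The reproducing kernel Hilbert space of a continuous kernel on a separable space is
separable. -/
lemma secondCountableTopology_of_continuous_kernelSection [TopologicalSpace X]
    [TopologicalSpace.SeparableSpace X] (hc : Continuous (kernelSection H : X → H)) :
    SecondCountableTopology H := by
  -- The kernel functions span a dense subspace and are multiples of kernel sections, which form a
  -- continuous image of a separable space.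
  have hsub : (Submodule.span ℝ {RKHS.kerFun H x v | (x : X) (v : ℝ)} : Set H) ⊆
      Submodule.span ℝ (Set.range (kernelSection H : X → H)) := by
    refine Submodule.span_le.2 ?_
    rintro _ ⟨x, v, rfl⟩
    have h : RKHS.kerFun H x v = v • kernelSection H x := by
      rw [kernelSection, ← map_smul, smul_eq_mul, mul_one]
    rw [h]
    exact Submodule.smul_mem _ _ (Submodule.subset_span ⟨x, rfl⟩)
  have hsep := ((TopologicalSpace.isSeparable_range hc).span (R := ℝ)).mono hsub
  have huniv : closure (Submodule.span ℝ {RKHS.kerFun H x v | (x : X) (v : ℝ)} : Set H) =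
      Set.univ := by
    rw [← Submodule.topologicalClosure_coe, RKHS.kerFun_dense, Submodule.top_coe]
  have : TopologicalSpace.SeparableSpace H := by
    rw [← TopologicalSpace.isSeparable_univ_iff, ← huniv]
    exact hsep.closure
  exact UniformSpace.secondCountable_of_separable H

end

lemma IsHolderLoss.comp_snd {X Y : Type*} [MeasurableSpace X] [MeasurableSpace Y] {φ : Y → ℝ → ℝ}
    {α L : ℝ} (h : IsHolderLoss φ α L) : IsHolderLoss (fun z : X × Y => φ z.2) α L where
  alpha_pos := h.alpha_pos
  alpha_le_one := h.alpha_le_one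
  L_pos := h.L_pos
  measurable := h.measurable.comp ((measurable_snd.comp measurable_fst).prodMk measurable_snd)
  nonneg z := h.nonneg z.2
  convex z := h.convex z.2
  differentiable z := h.differentiable z.2
  holder z := h.holder z.2

theorem theorem6 {d : ℕ} (X : Set (EuclideanSpace ℝ (Fin d))) (Y : Set ℝ)
    (ρ : Measure (X × Y)) [IsProbabilityMeasure ρ]
    -- the Mercer kernel and its reproducing kernel Hilbert space
    (K : X → X → ℝ) (hK : IsMercerKernel K)
    (H : Type*) [NormedAddCommGroup H] [InnerProductSpace ℝ H] [CompleteSpace H]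
    [RKHS ℝ H X ℝ] (hH : IsRKHSOf H K)
    (hκ : BddAbove (Set.range fun x : X => √(K x x)))
    -- the loss
    (φ : Y → ℝ → ℝ) (α L : ℝ) (hφ : IsHolderLoss φ α L)
    (hφ0 : BddAbove (Set.range fun y : Y => φ y 0))
    -- a minimizer of the generalization error over the space `H`
    (fH : H) (hfH : ∀ f : H, genError ρ φ fH ≤ genError ρ φ f)
    (hφH : BddAbove (Set.range fun z : X × Y => φ z.2 (fH z.1)))
    -- the step sizes
    (η : ℕ → ℝ) (hη_pos : ∀ t, 1 ≤ t → 0 < η t)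
    (hη_le : ∀ t, 1 ≤ t → selfBoundConst α L * kernelSup K ^ 2 * η t ≤ 1)
    (hη_anti : ∀ t, 1 ≤ t → η (t + 1) ≤ η t)
    (hη_sq : Summable fun t => η t ^ 2) :
    ∃ C : ℝ, ∀ (Ω : Type*) [MeasurableSpace Ω] (P : Measure Ω) [IsProbabilityMeasure P]
      (z : ℕ → Ω → X × Y),
      (∀ t, 1 ≤ t → Measurable (z t)) →
      iIndepFun (fun t : Set.Ici 1 => z t) P →
      (∀ t, 1 ≤ t → P.map (z t) = ρ) →
      ∀ T : ℕ, 2 ≤ T → ∀ δ : ℝ, 0 < δ → δ < 1 →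
        ENNReal.ofReal (1 - δ) ≤
          P {ω | genError ρ φ (ogd H φ η (fun t => z t ω) (T + 1)) - genError ρ φ fH ≤
            C * max (max (∑ t ∈ Finset.Icc (T / 2) T, η t)⁻¹ (η (T / 2) ^ α))
                (∑ t ∈ Finset.Icc (T / 2) T, η t ^ (1 + α)) *
              Real.log (3 * T / δ) ^ 2} := by
  borelize H
  have hΦ := continuous_kernelSection hK hH
  have : SecondCountableTopology H := secondCountableTopology_of_continuous_kernelSection hΦ
  obtain ⟨B, hB0, hB⟩ := exists_deriv_sq_le hφ.alpha_pos hφ.alpha_le_one hφ.L_pos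
  obtain ⟨M, hM⟩ := hφH
  let p : OnlineProblem (X × Y) H :=
    { ρ := ρ
      isProbabilityMeasure := inferInstance
      φ := fun z => φ z.2
      Φ := fun z => kernelSection H z.1
      α := α
      L := L
      κ := kernelSup K
      A := selfBoundConst α L
      B := B
      M := max M 0
      fH := fH
      holder := hφ.comp_snd
      measurable_feature := hΦ.measurable.comp measurable_fst
      norm_feature_le := fun z => norm_kernelSection_le hH hκ z.1
      κ_nonneg := Real.iSup_nonneg fun x => Real.sqrt_nonneg _
      A_nonneg := (selfBoundConst_pos hφ.alpha_pos hφ.L_pos).le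
      B_nonneg := hB0
      M_nonneg := le_max_right _ _
      deriv_sq_le := fun z s => hB _ (hφ.differentiable z.2) (hφ.nonneg z.2) (hφ.holder z.2) s
      loss_opt_le := fun z => by
        rw [inner_kernelSection]
        exact (hM ⟨z, rfl⟩).trans (le_max_left _ _)
      integral_opt_le := fun f => by
        simpa only [inner_kernelSection, genError] using hfH f }
  have hγ : p.IsStepSize fun n => η (n + 1) :=
    { pos := fun n => hη_pos _ (by omega)
      le := fun n => hη_le _ (by omega)
      antitone := antitone_nat_of_succ_le fun n => hη_anti _ (by omega)
      summable := (summable_nat_add_iff 1).2 hη_sq }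
  refine ⟨p.gapConst fun n => η (n + 1), fun Ω _ P _ z hz hind hlaw T hT δ hδ hδ1 => ?_⟩
  have hind' : iIndepFun (fun n => z (n + 1)) P :=
    hind.precomp (g := fun n : ℕ => (⟨n + 1, Nat.succ_pos n⟩ : Set.Ici 1))
      fun m n h => Nat.succ_injective (Subtype.ext_iff.1 h)
  -- Time is shifted by one: the abstract iterate `n` is `f_{n+1}`, so the window `[T / 2 - 1, T)`
  -- becomes `[T / 2, T]`. The truncated subtraction is harmless as `T ≥ 2`.
  have key := OnlineProblem.ofReal_one_sub_le_measure_gap_sgd_le hγ (fun i => hz (i + 1) (by omega))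
    hind' (fun i => hlaw (i + 1) (by omega)) (a := T / 2 - 1) (n := T) (by omega) hδ hδ1
  have hT2 : T / 2 - 1 + 1 = T / 2 := by omega
  have hsum : ∀ g : ℕ → ℝ, ∑ k ∈ Finset.Ico (T / 2 - 1) T, g (k + 1) =
      ∑ t ∈ Finset.Icc (T / 2) T, g t := by
    intro g
    rw [Finset.sum_Ico_add' g, hT2]
    rfl
  have hogd : ∀ w : ℕ → X × Y, ∀ n,
      ogd H φ η w (n + 1) = p.sgd (fun n => η (n + 1)) (fun n => w (n + 1)) n := by
    intro w n
    induction n with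
    | zero => rfl
    | succ n ih =>
      rw [ogd, ih, OnlineProblem.sgd, OnlineProblem.grad, OnlineProblem.dloss, smul_smul]
      simp only [p, inner_kernelSection]
  have hgap : ∀ f : H, genError ρ φ f - genError ρ φ fH = p.gap f := by
    intro f
    simp only [OnlineProblem.gap, OnlineProblem.risk, OnlineProblem.loss, genError, p,
      inner_kernelSection]
  simp only [hsum fun t => η t, hsum fun t => η t ^ (1 + p.α), hT2] at key
  simp only [hogd, hgap]
  exact key
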